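/- Let $k$ be a field, let $X$ be a projective scheme over $k$, and let $G$ be an affine group scheme of finite type over $k$ (for example a reductive algebraic group) whose character group $\mathrm{Hom}(G,\mathbb{G}_m)$ is trivial, acting on $X$. Let $\mathrm{Pic}^G(X)$ be the group of isomorphism classes of line bundles on $X$ with a $G$-linearisation, and call the elements of $\mathrm{Pic}^G(X)_{\mathbb{R}}=\mathrm{Pic}^G(X)\otimes_{\mathbb{Z}}\mathbb{R}$ virtual linearisations. The ample cone $\mathbf{A}^G(X)_{\mathbb{R}}\subset \mathrm{Pic}^G(X)_{\mathbb{R}}$ is the convex cone spanned by the classes of ample line bundles with a $G$-linearisation. Let $K$ be an algebraically closed field containing $k$ (for example an algebraic closure of $k$). For $x\in X(K)$ and a one-parameter subgroup $\lambda:\mathbb{G}_{m}\to G_K$ put $x_\infty=\lim_{t\to 0}\lambda(t^{-1})\cdot x$; for a linearised line bundle $L$, let $\mu^L(x,\lambda)\in\mathbb{Z}$ be the integer $r$ such that $\lambda$ acts on the fibre $L_{x_\infty}$ by the character $t\mapsto t^{r}$, and extend the homomorphism $\mu^{\bullet}(x,\lambda):\mathrm{Pic}^G(X)\to\mathbb{Z}$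 to an $\mathbb{R}$-linear map $\mathrm{Pic}^G(X)_{\mathbb{R}}\to\mathbb{R}$. Fix a maximal torus $T$ of $G_K$ and a Euclidean norm on $\mathcal{X}_*(T)\otimes\mathbb{R}$ invariant under the Weyl group $N_{G}(T)/T$; for a one-parameter subgroup $\lambda$ of $G_K$ let $\|\lambda\|=\|g\lambda g^{-1}\|$ for any $g\in G(K)$ with $g\lambda g^{-1}$ a one-parameter subgroup of $T$. For $l\in\mathrm{Pic}^G(X)_{\mathbb{R}}$ put $$M^l(x)=\sup_{\lambda\neq 1}\frac{\mu^l(x,\lambda)}{\|\lambda\|}\in\mathbb{R}\cup\{\pm\infty\},$$ the supremum being over all non-trivial one-parameter subgroups of $G_K$ (and $-\infty$ if there are none), and $$X^{ss}(l)=\{x\in X(K): M^l(x)\le 0\},\qquad X^{s}(l)=\{x\in X(K): M^l(x)<0\}.$$ Suppose that $\mathbf{H}\subset\mathbf{A}^G(X)_{\mathbb{R}}$ is a convex subset such that $X^{ss}(l)=X^{s}(l)$ for all $l\in\mathbf{H}$. Then $$X^{s}(l)=X^{ss}(l)=X^{ss}(l')=X^{s}(l')\qquad\text{for all } l,l'\in\mathbf{H}.$$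 -/

import Mathlib

open CategoryTheory AlgebraicGeometry

universe u

namespace VirtualGIT

open MonoidalCategory CartesianMonoidalCategory
open scoped TensorProduct MonObj

noncomputable section

section Points

variable {k : Type u} [Field k]

/-- `Spec R` as a scheme over `Spec k`. -/
abbrev specOver (k : Type u) [Field k] (R : Type u) [CommRing R] [Algebra k R] :
    Over (Spec (CommRingCat.of k)) :=
  Over.mk (Spec.map (CommRingCat.ofHom (algebraMap k R)))

/-- The morphism of `k`-schemes `Spec S ⟶ Spec R` given by a homomorphism of `k`-algebras. -/
def specOverMap {R S : Type u} [CommRing R] [Algebra k R] [CommRing S] [Algebra k S]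
    (f : R →ₐ[k] S) : specOver k S ⟶ specOver k R :=
  Over.homMk (Spec.map (CommRingCat.ofHom f.toRingHom)) (by
    simp only [Over.mk_left, Over.mk_hom, ← Spec.map_comp, ← CommRingCat.ofHom_comp]
    congr 2
    exact f.comp_algebraMap)

/-- The set `X(R)` of `R`-valued points of a `k`-scheme `X`. -/
abbrev Pt (X : Over (Spec (CommRingCat.of k))) (R : Type u) [CommRing R] [Algebra k R] : Type u :=
  specOver k R ⟶ X

variable {G X : Over (Spec (CommRingCat.of k))}

/-- The map `X(R) → X(S)` induced by a homomorphism `R → S` of `k`-algebras. -/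
def Pt.map {R S : Type u} [CommRing R] [Algebra k R] [CommRing S] [Algebra k S]
    (f : R →ₐ[k] S) (x : Pt X R) : Pt X S :=
  specOverMap f ≫ x

theorem Pt.map_id {R : Type u} [CommRing R] [Algebra k R] (x : Pt X R) :
    Pt.map (AlgHom.id k R) x = x := by
  have : specOverMap (AlgHom.id k R) = 𝟙 _ := by
    ext1; exact Spec.map_id _
  rw [Pt.map, this, Category.id_comp]

theorem Pt.map_map {R S A : Type u} [CommRing R] [Algebra k R] [CommRing S] [Algebra k S]
    [CommRing A] [Algebra k A] (f : R →ₐ[k] S) (g : S →ₐ[k] A) (x : Pt X R) :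
    Pt.map g (Pt.map f x) = Pt.map (g.comp f) x := by
  have : specOverMap (g.comp f) = specOverMap g ≫ specOverMap f := by
    ext1; exact Spec.map_comp (CommRingCat.ofHom f.toRingHom) (CommRingCat.ofHom g.toRingHom)
  rw [Pt.map, Pt.map, Pt.map, this, Category.assoc]

section Group
variable [GrpObj G]

theorem Pt.map_mul {R S : Type u} [CommRing R] [Algebra k R] [CommRing S] [Algebra k S]
    (f : R →ₐ[k] S) (g h : Pt G R) : Pt.map f (g * h) = Pt.map f g * Pt.map f h :=
  MonObj.comp_mul ..

theorem Pt.map_one {R S : Type u} [CommRing R] [Algebra k R] [CommRing S] [Algebra k S]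
    (f : R →ₐ[k] S) : Pt.map f (1 : Pt G R) = 1 :=
  MonObj.comp_one ..

/- The group `G(R)` acts on `X(R)` by Mathlib's instance for morphisms into a module object. -/

theorem Pt.map_smul [ModObj G X] {R S : Type u} [CommRing R] [Algebra k R] [CommRing S]
    [Algebra k S] (f : R →ₐ[k] S) (g : Pt G R) (x : Pt X R) :
    Pt.map f (g • x) = Pt.map f g • Pt.map f x :=
  ModObj.comp_smul ..

theorem Pt.inv_smul_of [ModObj G X] {R : Type u} [CommRing R] [Algebra k R] {g : Pt G R}
    {x y : Pt X R} (h : g • x = y) : g⁻¹ • y = x := by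
  rw [← h]
  exact inv_smul_smul g x

end Group
end Points
section LineBundles

variable {k : Type u} [Field k]

/-- A line bundle on a `k`-scheme `X`, described by its fibres over all affine-valued points:
for every `k`-algebra `R` and every `x ∈ X(R)`, the invertible `R`-module `L_x` of sections of
`x^* L` over `Spec R` (equivalently, of `R`-points of the total space of `L` lying over `x`),
together with the functorial pull-back maps `L_x → L_{f(x)}`, `v ↦ f^* v`, for homomorphisms
`f : R → S`. The pull-back maps are `f`-semilinear and induce isomorphisms `S ⊗_R L_x ≅ L_{f(x)}`;
as both sides are invertible `S`-modules, it suffices to say that the image generates. -/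
structure LineBundle (X : Over (Spec (CommRingCat.of k))) where
  /-- The module `L_x`. -/
  fib : ∀ {R : Type u} [CommRing R] [Algebra k R], Pt X R → Type u
  [addCommGroup : ∀ {R : Type u} [CommRing R] [Algebra k R] (x : Pt X R), AddCommGroup (fib x)]
  [module : ∀ {R : Type u} [CommRing R] [Algebra k R] (x : Pt X R), Module R (fib x)]
  [invertible : ∀ {R : Type u} [CommRing R] [Algebra k R] (x : Pt X R), Module.Invertible R (fib x)]
  /-- The pull-back map `L_x → L_y` for `y = f(x)`. -/
  pull : ∀ {R S : Type u} [CommRing R] [Algebra k R] [CommRing S] [Algebra k S] (f : R →ₐ[k] S)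
    (x : Pt X R) (y : Pt X S), x.map f = y → fib x →ₛₗ[(f : R →+* S)] fib y
  pull_id : ∀ {R : Type u} [CommRing R] [Algebra k R] (x : Pt X R)
    (h : x.map (AlgHom.id k R) = x) (v : fib x), pull (AlgHom.id k R) x x h v = v
  pull_pull : ∀ {R S A : Type u} [CommRing R] [Algebra k R] [CommRing S] [Algebra k S] [CommRing A]
    [Algebra k A] (f : R →ₐ[k] S) (g : S →ₐ[k] A) (x : Pt X R) (y : Pt X S) (z : Pt X A)
    (hf : x.map f = y) (hg : y.map g = z) (hgf : x.map (g.comp f) = z) (v : fib x),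
    pull g y z hg (pull f x y hf v) = pull (g.comp f) x z hgf v
  span_pull : ∀ {R S : Type u} [CommRing R] [Algebra k R] [CommRing S] [Algebra k S] (f : R →ₐ[k] S)
    (x : Pt X R) (y : Pt X S) (h : x.map f = y),
    Submodule.span S (Set.range (pull f x y h)) = ⊤

attribute [instance] LineBundle.addCommGroup LineBundle.module LineBundle.invertible

/-- A line bundle on `X` with a linearisation of the action of `G`: an action of `G` on (the total
space of) the line bundle, covering the action on `X` and linear on fibres. On `R`-valued points
it consists of linear maps `L_x → L_{gx}` for `g ∈ G(R)` and `x ∈ X(R)`. -/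
structure LinearisedLineBundle (G X : Over (Spec (CommRingCat.of k))) [GrpObj G] [ModObj G X]
    extends LineBundle X where
  /-- The map `L_x → L_y` for `y = g • x`. -/
  act : ∀ {R : Type u} [CommRing R] [Algebra k R] (g : Pt G R) (x y : Pt X R), g • x = y →
    fib x →ₗ[R] fib y
  act_one : ∀ {R : Type u} [CommRing R] [Algebra k R] (x : Pt X R) (h : (1 : Pt G R) • x = x)
    (v : fib x), act 1 x x h v = v
  act_act : ∀ {R : Type u} [CommRing R] [Algebra k R] (g g' : Pt G R) (x y z : Pt X R)
    (h : g • x = y) (h' : g' • y = z) (h'' : (g' * g) • x = z) (v : fib x),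
    act g' y z h' (act g x y h v) = act (g' * g) x z h'' v
  pull_act : ∀ {R S : Type u} [CommRing R] [Algebra k R] [CommRing S] [Algebra k S] (f : R →ₐ[k] S)
    (g : Pt G R) (x y : Pt X R) (x' y' : Pt X S) (h : g • x = y) (hx : x.map f = x')
    (hy : y.map f = y') (h' : g.map f • x' = y') (v : fib x),
    pull f y y' hy (act g x y h v) = act (g.map f) x' y' h' (pull f x x' hx v)

namespace LineBundle

variable {X : Over (Spec (CommRingCat.of k))}

/-- The trivial line bundle. -/
abbrev trivial (X : Over (Spec (CommRingCat.of k))) : LineBundle X where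
  fib {R} _ _ _ := R
  addCommGroup {R} _ _ _ := inferInstanceAs (AddCommGroup R)
  module {R} _ _ _ := inferInstanceAs (Module R R)
  invertible {R} _ _ _ := inferInstanceAs (Module.Invertible R R)
  pull f _ _ _ :=
    { toFun := f
      map_add' := map_add f
      map_smul' := map_mul f }
  pull_id _ _ _ := rfl
  pull_pull _ _ _ _ _ _ _ _ _ := rfl
  span_pull f _ _ _ := by
    rw [eq_top_iff, ← Ideal.span_singleton_one]
    exact Submodule.span_mono (Set.singleton_subset_iff.2 ⟨1, map_one f⟩)

/-- The tensor product of two line bundles. -/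
abbrev tensor (L M : LineBundle X) : LineBundle X where
  fib {R} _ _ x := L.fib x ⊗[R] M.fib x
  addCommGroup {R} _ _ x := inferInstanceAs (AddCommGroup (L.fib x ⊗[R] M.fib x))
  module {R} _ _ x := inferInstanceAs (Module R (L.fib x ⊗[R] M.fib x))
  invertible {R} _ _ x := inferInstanceAs (Module.Invertible R (L.fib x ⊗[R] M.fib x))
  pull f x y h := TensorProduct.map (L.pull f x y h) (M.pull f x y h)
  pull_id x h v := by
    induction v with
    | zero => exact map_zero _
    | add a b ha hb => rw [map_add, ha, hb]
    | tmul a b =>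
      exact (TensorProduct.map_tmul _ _ _ _).trans (by rw [L.pull_id, M.pull_id])
  pull_pull f g x y z hf hg hgf v := by
    induction v with
    | zero => simp
    | add a b ha hb => simp only [map_add, ha, hb]
    | tmul a b => simp [L.pull_pull _ _ _ _ _ _ _ hgf, M.pull_pull _ _ _ _ _ _ _ hgf]
  span_pull {R S} _ _ _ _ f x y h := by
    rw [eq_top_iff, ← TensorProduct.span_tmul_eq_top, Submodule.span_le]
    rintro _ ⟨a, b, rfl⟩
    have ha : a ∈ Submodule.span S (Set.range (L.pull f x y h)) := by simp [L.span_pull]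
    have hb : b ∈ Submodule.span S (Set.range (M.pull f x y h)) := by simp [M.span_pull]
    have hab := Submodule.apply_mem_map₂ (TensorProduct.mk S _ _) ha hb
    rw [Submodule.map₂_span_span] at hab
    refine Submodule.span_mono ?_ hab
    rintro _ ⟨_, ⟨a, rfl⟩, _, ⟨b, rfl⟩, rfl⟩
    exact ⟨a ⊗ₜ b, by simp⟩

theorem dual_aux (L : LineBundle X) {R S : Type u} [CommRing R] [Algebra k R] [CommRing S]
    [Algebra k S] (f : R →ₐ[k] S) (x : Pt X R) (y : Pt X S) (h : x.map f = y)
    (φ : Module.Dual R (L.fib x)) :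
    ∃ ψ : Module.Dual S (L.fib y), ∀ v, ψ (L.pull f x y h v) = f (φ v) := by
  let := (f : R →+* S).toAlgebra
  let : Module R (L.fib y) := Module.compHom _ (f : R →+* S)
  have : IsScalarTower R S (L.fib y) := ⟨fun r s v => mul_smul (f r) s v⟩
  let p : L.fib x →ₗ[R] L.fib y :=
    { toFun := L.pull f x y h
      map_add' := map_add _
      map_smul' := fun r v => (L.pull f x y h).map_smulₛₗ r v }
  have hp : Function.Bijective (p.liftBaseChange S) := by
    apply Module.Invertible.bijective_of_surjective
    rw [← LinearMap.range_eq_top, eq_top_iff, ← L.span_pull f x y h, Submodule.span_le]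
    rintro _ ⟨v, rfl⟩
    exact ⟨1 ⊗ₜ v, by simp [p]⟩
  let e := LinearEquiv.ofBijective _ hp
  have he (v) : e.symm (p v) = 1 ⊗ₜ v := by rw [LinearEquiv.symm_apply_eq]; simp [e]
  refine ⟨((Algebra.linearMap R S ∘ₗ φ).liftBaseChange S) ∘ₗ e.symm.toLinearMap, fun v => ?_⟩
  change ((Algebra.linearMap R S ∘ₗ φ).liftBaseChange S) (e.symm (p v)) = _
  rw [he]
  simp
  rfl

theorem dual_unique (L : LineBundle X) {R S : Type u} [CommRing R] [Algebra k R] [CommRing S]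
    [Algebra k S] (f : R →ₐ[k] S) (x : Pt X R) (y : Pt X S) (h : x.map f = y)
    {ψ ψ' : Module.Dual S (L.fib y)} (H : ∀ v, ψ (L.pull f x y h v) = ψ' (L.pull f x y h v)) :
    ψ = ψ' := by
  refine LinearMap.ext_on (L.span_pull f x y h) ?_
  rintro _ ⟨v, rfl⟩
  exact H v

/-- The pull-back map on dual fibres, characterised by `(f^* φ) (f^* v) = f (φ v)`. -/
def dualPull (L : LineBundle X) {R S : Type u} [CommRing R] [Algebra k R] [CommRing S]
    [Algebra k S] (f : R →ₐ[k] S) (x : Pt X R) (y : Pt X S) (h : x.map f = y) :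
    Module.Dual R (L.fib x) →ₛₗ[(f : R →+* S)] Module.Dual S (L.fib y) where
  toFun φ := (L.dual_aux f x y h φ).choose
  map_add' φ φ' := L.dual_unique f x y h fun v => by
    rw [(L.dual_aux f x y h (φ + φ')).choose_spec v, LinearMap.add_apply, LinearMap.add_apply,
      (L.dual_aux f x y h φ).choose_spec v, (L.dual_aux f x y h φ').choose_spec v, map_add]
  map_smul' r φ := L.dual_unique f x y h fun v => by
    rw [(L.dual_aux f x y h (r • φ)).choose_spec v, LinearMap.smul_apply, LinearMap.smul_apply,
      (L.dual_aux f x y h φ).choose_spec v, smul_eq_mul, map_mul]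
    rfl

theorem dualPull_apply (L : LineBundle X) {R S : Type u} [CommRing R] [Algebra k R] [CommRing S]
    [Algebra k S] (f : R →ₐ[k] S) (x : Pt X R) (y : Pt X S) (h : x.map f = y)
    (φ : Module.Dual R (L.fib x)) (v : L.fib x) :
    L.dualPull f x y h φ (L.pull f x y h v) = f (φ v) :=
  (L.dual_aux f x y h φ).choose_spec v

/-- The dual line bundle. -/
abbrev dual (L : LineBundle X) : LineBundle X where
  fib {R} _ _ x := Module.Dual R (L.fib x)
  addCommGroup {R} _ _ x := inferInstanceAs (AddCommGroup (Module.Dual R (L.fib x)))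
  module {R} _ _ x := inferInstanceAs (Module R (Module.Dual R (L.fib x)))
  invertible {R} _ _ x := inferInstanceAs (Module.Invertible R (Module.Dual R (L.fib x)))
  pull f x y h := L.dualPull f x y h
  pull_id {R} _ _ x h φ := L.dual_unique (AlgHom.id k R) x x h fun v => by
    rw [dualPull_apply, L.pull_id]; rfl
  pull_pull f g x y z hf hg hgf φ := L.dual_unique (g.comp f) x z hgf fun v => by
    rw [dualPull_apply, ← L.pull_pull f g x y z hf hg hgf, dualPull_apply, dualPull_apply]; rfl
  span_pull {R S} _ _ _ _ f x y h := by
    set N := Submodule.span S (Set.range (L.dualPull f x y h)) with hN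
    have hs : Function.Surjective (N.subtype.rTensor (L.fib y)) := by
      have key (t : Module.Dual R (L.fib x) ⊗[R] L.fib x) : f (contractLeft R (L.fib x) t) ∈
          LinearMap.range (contractLeft S (L.fib y) ∘ₗ N.subtype.rTensor (L.fib y)) := by
        induction t with
        | zero => simp
        | add a b ha hb => rw [map_add, map_add]; exact add_mem ha hb
        | tmul φ v =>
          refine ⟨⟨L.dualPull f x y h φ, Submodule.subset_span ⟨φ, rfl⟩⟩ ⊗ₜ L.pull f x y h v, ?_⟩
          simp [dualPull_apply]
      obtain ⟨t, ht⟩ := (Module.Invertible.bijective (R := R) (M := L.fib x)).2 1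
      obtain ⟨w, hw⟩ := key t
      rw [ht, map_one, LinearMap.comp_apply] at hw
      intro z
      refine ⟨contractLeft S (L.fib y) z • w,
        (Module.Invertible.bijective (R := S) (M := L.fib y)).1 ?_⟩
      rw [map_smul, map_smul, hw, smul_eq_mul, mul_one]
    have := (Module.Invertible.rTensor_surjective_iff _).1 hs
    rwa [← LinearMap.range_eq_top, Submodule.range_subtype] at this

end LineBundle
namespace LinearisedLineBundle

variable {G X : Over (Spec (CommRingCat.of k))} [GrpObj G] [ModObj G X]

/-- The trivial line bundle with its trivial linearisation. -/
abbrev trivial (G X : Over (Spec (CommRingCat.of k))) [GrpObj G] [ModObj G X] :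
    LinearisedLineBundle G X where
  toLineBundle := LineBundle.trivial X
  act {R} _ _ _ _ _ _ := (LinearMap.id : R →ₗ[R] R)
  act_one _ _ _ := rfl
  act_act _ _ _ _ _ _ _ _ _ := rfl
  pull_act _ _ _ _ _ _ _ _ _ _ _ := rfl

/-- The tensor product of two linearised line bundles. -/
abbrev tensor (L M : LinearisedLineBundle G X) : LinearisedLineBundle G X where
  toLineBundle := L.toLineBundle.tensor M.toLineBundle
  act g x y h := TensorProduct.map (L.act g x y h) (M.act g x y h)
  act_one x h v := by
    change L.fib _ ⊗[_] M.fib _ at v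
    induction v with
    | zero => exact map_zero _
    | add a b ha hb => rw [map_add, ha, hb]
    | tmul a b => exact (TensorProduct.map_tmul _ _ _ _).trans (by rw [L.act_one, M.act_one])
  act_act g g' x y z h h' h'' v := by
    change L.fib _ ⊗[_] M.fib _ at v
    induction v with
    | zero => simp
    | add a b ha hb => simp only [map_add, ha, hb]
    | tmul a b => simp only [TensorProduct.map_tmul, L.act_act _ _ _ _ _ _ _ h'', M.act_act _ _ _ _ _ _ _ h'']
  pull_act f g x y x' y' h hx hy h' v := by
    change TensorProduct.map _ _ (TensorProduct.map _ _ v) =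
      TensorProduct.map _ _ (TensorProduct.map _ _ v)
    change L.fib _ ⊗[_] M.fib _ at v
    induction v with
    | zero => simp
    | add a b ha hb => simp only [map_add, ha, hb]
    | tmul a b =>
      simp only [TensorProduct.map_tmul, L.pull_act f g x y x' y' h hx hy h',
        M.pull_act f g x y x' y' h hx hy h']

theorem act_inv_act (L : LinearisedLineBundle G X) {R : Type u} [CommRing R] [Algebra k R]
    (g : Pt G R) (x y : Pt X R) (h : g • x = y) (h' : g⁻¹ • y = x) (v : L.fib x) :
    L.act g⁻¹ y x h' (L.act g x y h v) = v := by
  rw [L.act_act g g⁻¹ x y x h h' (by rw [inv_mul_cancel]; exact one_smul _ x)]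
  have : ∀ (a : Pt G R) (_ : a = 1) (ha : a • x = x), L.act a x x ha v = v := by
    rintro _ rfl ha; exact L.act_one _ _ _
  exact this _ (inv_mul_cancel g) _

/-- The dual of a linearised line bundle, with the contragredient linearisation. -/
abbrev dual (L : LinearisedLineBundle G X) : LinearisedLineBundle G X where
  toLineBundle := L.toLineBundle.dual
  act g x y h := (L.act g⁻¹ y x (Pt.inv_smul_of h)).dualMap
  act_one {R} _ _ x h φ := by
    refine LinearMap.ext fun v => congrArg (fun w => (φ : Module.Dual R (L.fib x)) w) ?_
    have : ∀ (a : Pt G R) (_ : a = 1) (ha : a • x = x), L.act a x x ha v = v := by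
      rintro _ rfl ha; exact L.act_one _ _ _
    exact this _ inv_one _
  act_act {R} _ _ g g' x y z h h' h'' φ := by
    refine LinearMap.ext fun v => congrArg (fun w => (φ : Module.Dual R (L.fib x)) w) ?_
    have : ∀ (a : Pt G R) (_ : a = g⁻¹ * g'⁻¹) (ha : a • z = x) (hg hg'),
        L.act g⁻¹ y x hg (L.act g'⁻¹ z y hg' v) = L.act a z x ha v := by
      rintro _ rfl ha _ _; exact L.act_act _ _ _ _ _ _ _ _ _
    exact this _ (mul_inv_rev _ _) _ _ _
  pull_act {R S} _ _ _ _ f g x y x' y' h hx hy h' φ := by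
    refine L.dual_unique f y y' hy fun v => ?_
    have hg : (Pt.map f g)⁻¹ = Pt.map f g⁻¹ := by
      rw [inv_eq_iff_mul_eq_one, ← Pt.map_mul, mul_inv_cancel, Pt.map_one]
    have h1 : g⁻¹ • y = x := Pt.inv_smul_of h
    have e : ∀ (a : Pt G S) (_ : a = Pt.map f g⁻¹) (ha : a • y' = x'),
        L.act a y' x' ha (L.pull f y y' hy v) = L.pull f x x' hx (L.act g⁻¹ y x h1 v) := by
      rintro _ rfl ha; exact (L.pull_act f g⁻¹ y x y' x' h1 hy hx ha v).symm
    refine (L.dualPull_apply f y y' hy _ v).trans ?_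
    change _ = L.dualPull f x x' hx φ (L.act (Pt.map f g)⁻¹ y' x' _ (L.pull f y y' hy v))
    rw [e _ hg]
    exact (L.dualPull_apply f x x' hx φ _).symm

/-- Two linearised line bundles are isomorphic. -/
def Isom (L M : LinearisedLineBundle G X) : Prop :=
  ∃ e : ∀ {R : Type u} [CommRing R] [Algebra k R] (x : Pt X R), L.fib x ≃ₗ[R] M.fib x,
    (∀ {R S : Type u} [CommRing R] [Algebra k R] [CommRing S] [Algebra k S] (f : R →ₐ[k] S)
      (x : Pt X R) (y : Pt X S) (h : x.map f = y) (v : L.fib x),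
      e y (L.pull f x y h v) = M.pull f x y h (e x v)) ∧
    (∀ {R : Type u} [CommRing R] [Algebra k R] (g : Pt G R) (x y : Pt X R) (h : g • x = y)
      (v : L.fib x), e y (L.act g x y h v) = M.act g x y h (e x v))

theorem Isom.refl (L : LinearisedLineBundle G X) : Isom L L :=
  ⟨fun _ => LinearEquiv.refl _ _, fun _ _ _ _ _ => rfl, fun _ _ _ _ _ => rfl⟩

theorem Isom.symm {L M : LinearisedLineBundle G X} : Isom L M → Isom M L := by
  rintro ⟨e, h1, h2⟩
  refine ⟨fun x => (e x).symm, fun f x y h v => ?_, fun g x y h v => ?_⟩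
  · rw [LinearEquiv.symm_apply_eq, h1, LinearEquiv.apply_symm_apply]
  · rw [LinearEquiv.symm_apply_eq, h2, LinearEquiv.apply_symm_apply]

theorem Isom.trans {L M N : LinearisedLineBundle G X} : Isom L M → Isom M N → Isom L N := by
  rintro ⟨e, h1, h2⟩ ⟨e', h1', h2'⟩
  refine ⟨fun x => (e x).trans (e' x), fun f x y h v => ?_, fun g x y h v => ?_⟩
  · simp [h1, h1']
  · simp [h2, h2']

theorem Isom.tensor {L L' M M' : LinearisedLineBundle G X} :
    Isom L L' → Isom M M' → Isom (L.tensor M) (L'.tensor M') := by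
  rintro ⟨e, h1, h2⟩ ⟨e', h1', h2'⟩
  refine ⟨fun x => TensorProduct.congr (e x) (e' x), fun f x y h v => ?_, fun g x y h v => ?_⟩
  · change TensorProduct.congr (e y) (e' y) (TensorProduct.map _ _ v) =
      TensorProduct.map _ _ (TensorProduct.congr (e x) (e' x) v)
    change L.fib _ ⊗[_] M.fib _ at v
    induction v with
    | zero => simp
    | add a b ha hb => simp only [map_add, ha, hb]
    | tmul a b => simp [h1, h1']
  · change TensorProduct.congr (e y) (e' y) (TensorProduct.map _ _ v) =
      TensorProduct.map _ _ (TensorProduct.congr (e x) (e' x) v)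
    change L.fib _ ⊗[_] M.fib _ at v
    induction v with
    | zero => simp
    | add a b ha hb => simp only [map_add, ha, hb]
    | tmul a b => simp [h2, h2']

theorem tensor_comm (L M : LinearisedLineBundle G X) : Isom (L.tensor M) (M.tensor L) := by
  refine ⟨fun {R} _ _ x => TensorProduct.comm R (L.fib x) (M.fib x),
    fun {R S} _ _ _ _ f x y h v => ?_, fun {R} _ _ g x y h v => ?_⟩
  · change TensorProduct.comm S _ _ (TensorProduct.map _ _ v) =
      TensorProduct.map _ _ (TensorProduct.comm R _ _ v)
    change L.fib _ ⊗[_] M.fib _ at v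
    induction v with
    | zero => simp
    | add a b ha hb => simp only [map_add, ha, hb]
    | tmul a b => simp
  · change TensorProduct.comm R _ _ (TensorProduct.map _ _ v) =
      TensorProduct.map _ _ (TensorProduct.comm R _ _ v)
    change L.fib _ ⊗[_] M.fib _ at v
    induction v with
    | zero => simp
    | add a b ha hb => simp only [map_add, ha, hb]
    | tmul a b => simp

theorem tensor_assoc (L M N : LinearisedLineBundle G X) :
    Isom ((L.tensor M).tensor N) (L.tensor (M.tensor N)) := by
  refine ⟨fun {R} _ _ x => TensorProduct.assoc R (L.fib x) (M.fib x) (N.fib x),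
    fun {R S} _ _ _ _ f x y h v => ?_, fun {R} _ _ g x y h v => ?_⟩
  · change TensorProduct.assoc S _ _ _ (TensorProduct.map (TensorProduct.map _ _) _ v) =
      TensorProduct.map _ (TensorProduct.map _ _) (TensorProduct.assoc R _ _ _ v)
    change (L.fib _ ⊗[_] M.fib _) ⊗[_] N.fib _ at v
    induction v with
    | zero => simp
    | add a b ha hb => simp only [map_add, ha, hb]
    | tmul a c =>
      induction a with
      | zero => simp
      | add a b ha hb => simp only [TensorProduct.add_tmul, map_add, ha, hb]
      | tmul a b => simp
  · change TensorProduct.assoc R _ _ _ (TensorProduct.map (TensorProduct.map _ _) _ v) =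
      TensorProduct.map _ (TensorProduct.map _ _) (TensorProduct.assoc R _ _ _ v)
    change (L.fib _ ⊗[_] M.fib _) ⊗[_] N.fib _ at v
    induction v with
    | zero => simp
    | add a b ha hb => simp only [map_add, ha, hb]
    | tmul a c =>
      induction a with
      | zero => simp
      | add a b ha hb => simp only [TensorProduct.add_tmul, map_add, ha, hb]
      | tmul a b => simp

theorem trivial_tensor (L : LinearisedLineBundle G X) : Isom ((trivial G X).tensor L) L := by
  refine ⟨fun {R} _ _ x => TensorProduct.lid R (L.fib x),
    fun {R S} _ _ _ _ f x y h v => ?_, fun {R} _ _ g x y h v => ?_⟩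
  · change TensorProduct.lid S (L.fib y) (TensorProduct.map ((LineBundle.trivial X).pull f x y h)
      (L.pull f x y h) v) = L.pull f x y h (TensorProduct.lid R (L.fib x) v)
    change R ⊗[R] L.fib _ at v
    induction v with
    | zero => simp
    | add a b ha hb => simp only [map_add, ha, hb]
    | tmul a b =>
      rw [TensorProduct.map_tmul]
      erw [TensorProduct.lid_tmul, TensorProduct.lid_tmul, LinearMap.map_smulₛₗ]
      rfl
  · change TensorProduct.lid R (L.fib y) (TensorProduct.map (LinearMap.id : R →ₗ[R] R)
      (L.act g x y h) v) = L.act g x y h (TensorProduct.lid R (L.fib x) v)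
    change R ⊗[R] L.fib _ at v
    induction v with
    | zero => simp
    | add a b ha hb => simp only [map_add, ha, hb]
    | tmul a b => simp

theorem dual_tensor (L : LinearisedLineBundle G X) : Isom (L.dual.tensor L) (trivial G X) := by
  refine ⟨fun {R} _ _ x => Module.Invertible.linearEquiv R (L.fib x),
    fun {R S} _ _ _ _ f x y h v => ?_, fun {R} _ _ g x y h v => ?_⟩
  · change contractLeft S (L.fib y) (TensorProduct.map (L.dualPull f x y h) (L.pull f x y h) v) =
      f (contractLeft R (L.fib x) v)
    change Module.Dual R (L.fib x) ⊗[R] L.fib x at v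
    induction v with
    | zero => simp
    | add a b ha hb => simp only [map_add, ha, hb]
    | tmul a b => simp [L.dualPull_apply]
  · change contractLeft R (L.fib y) (TensorProduct.map
      (L.act g⁻¹ y x (Pt.inv_smul_of h)).dualMap (L.act g x y h) v) =
      contractLeft R (L.fib x) v
    change Module.Dual R (L.fib x) ⊗[R] L.fib x at v
    induction v with
    | zero => simp
    | add a b ha hb => simp only [map_add, ha, hb]
    | tmul a b => simp [L.act_inv_act]

instance setoid (G X : Over (Spec (CommRingCat.of k))) [GrpObj G] [ModObj G X] :
    Setoid (LinearisedLineBundle G X) where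
  r := Isom
  iseqv := ⟨Isom.refl, Isom.symm, Isom.trans⟩

end LinearisedLineBundle

/-- The group `Pic^G(X)` of isomorphism classes of line bundles on `X` together with a
linearisation of the action of `G`. -/
def PicG (G X : Over (Spec (CommRingCat.of k))) [GrpObj G] [ModObj G X] : Type (u + 1) :=
  Quotient (LinearisedLineBundle.setoid G X)

namespace PicG

variable {G X : Over (Spec (CommRingCat.of k))} [GrpObj G] [ModObj G X]

/-- The class of a linearised line bundle. -/
def mk (L : LinearisedLineBundle G X) : PicG G X := Quotient.mk _ L

theorem mk_eq_mk {L M : LinearisedLineBundle G X} : mk L = mk M ↔ L.Isom M := Quotient.eq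

instance : Mul (PicG G X) :=
  ⟨Quotient.map₂ LinearisedLineBundle.tensor fun _ _ h _ _ h' => h.tensor h'⟩

instance : One (PicG G X) := ⟨mk (LinearisedLineBundle.trivial G X)⟩

theorem mk_mul (L M : LinearisedLineBundle G X) : mk L * mk M = mk (L.tensor M) := rfl

theorem exists_mul_eq_one (a : PicG G X) : ∃ b : PicG G X, b * a = 1 := by
  induction a using Quotient.inductionOn with
  | h L => exact ⟨mk L.dual, Quotient.sound L.dual_tensor⟩

instance : Inv (PicG G X) := ⟨fun a => a.exists_mul_eq_one.choose⟩

instance : CommGroup (PicG G X) :=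
  { Group.ofLeftAxioms
      (by
        intro a b c
        induction a using Quotient.inductionOn
        induction b using Quotient.inductionOn
        induction c using Quotient.inductionOn
        exact Quotient.sound (LinearisedLineBundle.tensor_assoc _ _ _))
      (by
        intro a
        induction a using Quotient.inductionOn
        exact Quotient.sound (LinearisedLineBundle.trivial_tensor _))
      (fun a => a.exists_mul_eq_one.choose_spec) with
    mul_comm := by
      intro a b
      induction a using Quotient.inductionOn
      induction b using Quotient.inductionOn
      exact Quotient.sound (LinearisedLineBundle.tensor_comm _ _) }

end PicG

end LineBundles
section Ample

variable {k : Type u} [Field k]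

attribute [local instance] MvPolynomial.gradedAlgebra in
/-- Projective `n`-space over `k`. -/
def projectiveSpace (k : Type u) [Field k] (n : ℕ) : Over (Spec (CommRingCat.of k)) :=
  Over.mk (Proj.toSpecZero (MvPolynomial.homogeneousSubmodule (Fin (n + 1)) k) ≫
    Spec.map (CommRingCat.ofHom
      (algebraMap k (MvPolynomial.homogeneousSubmodule (Fin (n + 1)) k 0))))

/-- A `k`-scheme is projective if it is a closed subscheme of some projective space. -/
def IsProjective (X : Over (Spec (CommRingCat.of k))) : Prop :=
  ∃ (n : ℕ) (i : X ⟶ projectiveSpace k n), IsClosedImmersion i.left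

namespace LineBundle

variable {X : Over (Spec (CommRingCat.of k))}

/-- The tensor power `L^{⊗ n}`. -/
def pow (L : LineBundle X) : ℕ → LineBundle X
  | 0 => trivial X
  | n + 1 => (pow L n).tensor L

/-- A global section of a line bundle: a compatible family of elements `s(x) ∈ L_x`. -/
structure GlobalSection (L : LineBundle X) where
  /-- The value `s(x)`. -/
  val : ∀ {R : Type u} [CommRing R] [Algebra k R] (x : Pt X R), L.fib x
  pull_val : ∀ {R S : Type u} [CommRing R] [Algebra k R] [CommRing S] [Algebra k S] (f : R →ₐ[k] S)
    (x : Pt X R) (y : Pt X S) (h : x.map f = y), L.pull f x y h (val x) = val y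

/-- `U` is the non-vanishing locus `X_s` of the section `s`: a field-valued point `y` factors
through `U` if and only if `s(y) ≠ 0`. -/
def GlobalSection.IsNonvanishingLocus {L : LineBundle X} (s : L.GlobalSection)
    (U : X.left.Opens) : Prop :=
  ∀ (F : Type u) [Field F] [Algebra k F] (y : Pt X F),
    Set.range (y.left : Spec (CommRingCat.of F) → X.left) ⊆ U ↔ s.val y ≠ 0

/-- A line bundle `L` on a (quasi-compact) scheme `X` is ample if every point of `X` has an affine
neighbourhood of the form `X_s` for a section `s` of a positive power of `L`. -/
def IsAmple (L : LineBundle X) : Prop :=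
  ∀ p : X.left, ∃ n : ℕ, 0 < n ∧ ∃ (s : (L.pow n).GlobalSection) (U : X.left.Opens),
    IsAffineOpen U ∧ s.IsNonvanishingLocus U ∧ p ∈ U

end LineBundle

variable (G X : Over (Spec (CommRingCat.of k))) [GrpObj G] [ModObj G X]

/-- The real vector space `Pic^G(X)_ℝ = Pic^G(X) ⊗ ℝ` of virtual linearisations. -/
abbrev VirtualLinearisation : Type (u + 1) := ℝ ⊗[ℤ] Additive (PicG G X)

/-- The ample cone `A^G(X)_ℝ`: the convex cone in `Pic^G(X)_ℝ` spanned by the ample line bundles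
with a linearisation. -/
def ampleCone : ConvexCone ℝ (VirtualLinearisation G X) :=
  ConvexCone.hull ℝ {l | ∃ L : LinearisedLineBundle G X, L.toLineBundle.IsAmple ∧
    l = 1 ⊗ₜ[ℤ] Additive.ofMul (PicG.mk L)}

end Ample

section OneParameterSubgroups

variable {k : Type u} [Field k]

/-- A character `G ⟶ 𝔾_m` over `k`, given on `R`-valued points. -/
structure Character (G : Over (Spec (CommRingCat.of k))) [GrpObj G] where
  app : ∀ (R : Type u) [CommRing R] [Algebra k R], Pt G R →* Rˣ
  naturality : ∀ {R S : Type u} [CommRing R] [Algebra k R] [CommRing S] [Algebra k S]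
    (f : R →ₐ[k] S) (g : Pt G R), app S (g.map f) = Units.map (f : R →* S) (app R g)

/-- The character group of `G` is trivial. -/
def HasTrivialCharacterGroup (G : Over (Spec (CommRingCat.of k))) [GrpObj G] : Prop :=
  ∀ (χ : Character G) (R : Type u) [CommRing R] [Algebra k R] (g : Pt G R), χ.app R g = 1

variable (K : Type u) [Field K] [Algebra k K]

/-- A one-parameter subgroup of `G_K`, i.e. a homomorphism `𝔾_m ⟶ G` over `K`, given on
points with values in `K`-algebras `R`. -/
@[ext]
structure OnePS (G : Over (Spec (CommRingCat.of k))) [GrpObj G] where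
  app : ∀ (R : Type u) [CommRing R] [Algebra k R] [Algebra K R] [IsScalarTower k K R],
    Rˣ →* Pt G R
  naturality : ∀ {R S : Type u} [CommRing R] [Algebra k R] [Algebra K R] [IsScalarTower k K R]
    [CommRing S] [Algebra k S] [Algebra K S] [IsScalarTower k K S] (f : R →ₐ[K] S) (u : Rˣ),
    app S (Units.map (f : R →* S) u) = (app R u).map (f.restrictScalars k)

/-- An (automatically split, for algebraically closed `K`) torus of rank `n` in `G_K`, given as a
homomorphism `𝔾_m^n ⟶ G` over `K` which is a monomorphism, i.e. injective on points with values in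
`K`-algebras. -/
structure Torus (G : Over (Spec (CommRingCat.of k))) [GrpObj G] (n : ℕ) where
  app : ∀ (R : Type u) [CommRing R] [Algebra k R] [Algebra K R] [IsScalarTower k K R],
    (Fin n → Rˣ) →* Pt G R
  naturality : ∀ {R S : Type u} [CommRing R] [Algebra k R] [Algebra K R] [IsScalarTower k K R]
    [CommRing S] [Algebra k S] [Algebra K S] [IsScalarTower k K S] (f : R →ₐ[K] S)
    (t : Fin n → Rˣ),
    app S (fun i => Units.map (f : R →* S) (t i)) = (app R t).map (f.restrictScalars k)
  injective : ∀ (R : Type u) [CommRing R] [Algebra k R] [Algebra K R] [IsScalarTower k K R],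
    Function.Injective (app R)

variable {K} {G X : Over (Spec (CommRingCat.of k))} [GrpObj G] [ModObj G X]

/-- The base change to a `K`-algebra `R` of a `K`-valued point. -/
abbrev Pt.baseChange {Y : Over (Spec (CommRingCat.of k))} (y : Pt Y K) (R : Type u) [CommRing R]
    [Algebra k R] [Algebra K R] [IsScalarTower k K R] : Pt Y R :=
  y.map (IsScalarTower.toAlgHom k K R)

theorem Pt.baseChange_map {Y : Over (Spec (CommRingCat.of k))} (y : Pt Y K) {R S : Type u}
    [CommRing R] [Algebra k R] [Algebra K R] [IsScalarTower k K R]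
    [CommRing S] [Algebra k S] [Algebra K S] [IsScalarTower k K S] (f : R →ₐ[K] S) :
    (y.baseChange R).map (f.restrictScalars k) = y.baseChange S := by
  rw [Pt.map_map]
  congr 1
  ext a
  exact f.commutes a

/-- The conjugate `g λ g⁻¹` of a one-parameter subgroup by `g ∈ G(K)`. -/
def OnePS.conj (lam : OnePS K G) (g : Pt G K) : OnePS K G where
  app R _ _ _ _ := (MulAut.conj (g.baseChange R)).toMonoidHom.comp (lam.app R)
  naturality {R S} _ _ _ _ _ _ _ _ f u := by
    have hinv : (g.baseChange S)⁻¹ = (g.baseChange R)⁻¹.map (f.restrictScalars k) := by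
      rw [inv_eq_iff_mul_eq_one, ← Pt.baseChange_map g f, ← Pt.map_mul, mul_inv_cancel, Pt.map_one]
    change g.baseChange S * lam.app S _ * (g.baseChange S)⁻¹ =
      Pt.map _ (g.baseChange R * lam.app R u * (g.baseChange R)⁻¹)
    rw [lam.naturality, hinv, Pt.map_mul, Pt.map_mul, Pt.baseChange_map]

/-- The one-parameter subgroup `λ` is non-trivial. -/
def OnePS.IsNontrivial (lam : OnePS K G) : Prop :=
  ∃ (R : Type u) (_ : CommRing R) (_ : Algebra k R) (_ : Algebra K R) (_ : IsScalarTower k K R)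
    (u : Rˣ), lam.app R u ≠ 1

namespace Torus

variable {n : ℕ}

/-- `T` is a maximal torus of `G_K`: every torus of `G_K` containing `T` equals `T`. -/
def IsMaximal (T : Torus K G n) : Prop :=
  ∀ (m : ℕ) (T' : Torus K G m),
    (∀ (R : Type u) [CommRing R] [Algebra k R] [Algebra K R] [IsScalarTower k K R],
      (T.app R).range ≤ (T'.app R).range) →
    ∀ (R : Type u) [CommRing R] [Algebra k R] [Algebra K R] [IsScalarTower k K R],
      (T'.app R).range ≤ (T.app R).range

/-- The one-parameter subgroup `u ↦ T(u^{a_1}, …, u^{a_n})` of `T` given by `a ∈ ℤ^n`. This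
identifies `ℤ^n` with the group of one-parameter subgroups of `T`. -/
def cochar (T : Torus K G n) (a : Fin n → ℤ) : OnePS K G where
  app R _ _ _ _ :=
    { toFun := fun u => T.app R fun i => u ^ a i
      map_one' := by
        rw [← map_one (T.app R)]
        exact congrArg _ (funext fun i => one_zpow _)
      map_mul' := fun u v => by
        rw [← map_mul]
        exact congrArg _ (funext fun i => mul_zpow u v _) }
  naturality {R S} _ _ _ _ _ _ _ _ f u := by
    refine Eq.trans ?_ (T.naturality f _)
    exact congrArg _ (funext fun i => (map_zpow (Units.map (f : R →* S)) u (a i)).symm)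

/-- The `K`-points of the normaliser `N_G(T)`. -/
def IsNormalising (T : Torus K G n) (g : Pt G K) : Prop :=
  ∀ (R : Type u) [CommRing R] [Algebra k R] [Algebra K R] [IsScalarTower k K R] (h : Pt G R),
    g.baseChange R * h * (g.baseChange R)⁻¹ ∈ (T.app R).range ↔ h ∈ (T.app R).range

/-- A Euclidean norm on `ℝ^n = X_*(T) ⊗ ℝ` which is invariant under the Weyl group
`N_G(T) / T`, given by the Gram matrix of its inner product. -/
structure InvariantNorm (T : Torus K G n) where
  gram : Matrix (Fin n) (Fin n) ℝ
  posDef : gram.PosDef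
  invariant : ∀ g : Pt G K, T.IsNormalising g → ∀ a b : Fin n → ℤ,
    (T.cochar a).conj g = T.cochar b →
    (fun i => (a i : ℝ)) ⬝ᵥ gram.mulVec (fun i => (a i : ℝ)) =
      (fun i => (b i : ℝ)) ⬝ᵥ gram.mulVec (fun i => (b i : ℝ))

/-- The norm of the one-parameter subgroup of `T` given by `a ∈ ℤ^n`. -/
def InvariantNorm.ofCochar {T : Torus K G n} (N : T.InvariantNorm) (a : Fin n → ℤ) : ℝ :=
  √((fun i => (a i : ℝ)) ⬝ᵥ N.gram.mulVec (fun i => (a i : ℝ)))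

open Classical in
/-- The norm `‖λ‖` of a one-parameter subgroup of `G_K`, defined as `‖g λ g⁻¹‖` for any `g ∈ G(K)`
such that `g λ g⁻¹` is a one-parameter subgroup of the maximal torus `T` (such `g` always exists,
and the norm does not depend on it by invariance under the Weyl group). -/
def InvariantNorm.norm {T : Torus K G n} (N : T.InvariantNorm) (lam : OnePS K G) : ℝ :=
  if h : ∃ (a : Fin n → ℤ) (g : Pt G K), lam.conj g = T.cochar a then N.ofCochar h.choose else 0

end Torus

end OneParameterSubgroups
section Stability

open scoped LaurentPolynomial

variable {k : Type u} [Field k] {K : Type u} [Field K] [Algebra k K]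
variable {G X : Over (Spec (CommRingCat.of k))} [GrpObj G] [ModObj G X]

/-- The coordinate `T` of `𝔾_m` as a unit. -/
def unitT (K : Type u) [Field K] : K[T;T⁻¹]ˣ where
  val := LaurentPolynomial.T 1
  inv := LaurentPolynomial.T (-1)
  val_inv := by rw [← LaurentPolynomial.T_add]; simp
  inv_val := by rw [← LaurentPolynomial.T_add]; simp

/-- The morphism `φ : 𝔸¹ ⟶ X` over `K` extends the morphism `𝔾_m ⟶ X`, `t ↦ λ(t⁻¹) • x`. -/
def OnePS.IsExtension (lam : OnePS K G) (x : Pt X K) (φ : Pt X (Polynomial K)) : Prop :=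
  φ.map ((Polynomial.toLaurentAlg (R := K)).restrictScalars k) =
    lam.app K[T;T⁻¹] (unitT K)⁻¹ • x.baseChange K[T;T⁻¹]

open Classical in
/-- The limit point `x_∞ = lim_{t → 0} λ(t⁻¹) • x`: the value at `0` of the extension of
`t ↦ λ(t⁻¹) • x` to `𝔸¹`. For proper `X` the extension exists and is unique (otherwise the
value is not meaningful). -/
def OnePS.limit (lam : OnePS K G) (x : Pt X K) : Pt X K :=
  if h : ∃ φ : Pt X (Polynomial K), lam.IsExtension x φ then
    h.choose.map ((Polynomial.aeval (0 : K)).restrictScalars k)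
  else x

/-- The point `y` is fixed by the one-parameter subgroup `λ`. -/
def OnePS.Fixes (lam : OnePS K G) (y : Pt X K) : Prop :=
  ∀ (R : Type u) [CommRing R] [Algebra k R] [Algebra K R] [IsScalarTower k K R] (u : Rˣ),
    lam.app R u • y.baseChange R = y.baseChange R

/-- The one-parameter subgroup `λ` acts on the fibre `L_y` at the fixed point `y` via the
character `t ↦ t^r`. -/
def OnePS.HasWeight (lam : OnePS K G) (y : Pt X K) (L : LinearisedLineBundle G X) (r : ℤ) : Prop :=
  ∀ (R : Type u) [CommRing R] [Algebra k R] [Algebra K R] [IsScalarTower k K R] (u : Rˣ)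
    (h : lam.app R u • y.baseChange R = y.baseChange R) (v : L.fib (y.baseChange R)),
    L.act (lam.app R u) _ _ h v = ((u ^ r : Rˣ) : R) • v

/-- The homomorphism `K[T;T⁻¹] → R`, `T ↦ u`. -/
def evalUnit {R : Type u} [CommRing R] [Algebra K R] (u : Rˣ) : K[T;T⁻¹] →ₐ[K] R :=
  AddMonoidAlgebra.lift K R ℤ ((Units.coeHom R).comp (zpowersHom Rˣ u))

theorem evalUnit_T {R : Type u} [CommRing R] [Algebra K R] (u : Rˣ) (n : ℤ) :
    evalUnit (K := K) u (LaurentPolynomial.T n) = ((u ^ n : Rˣ) : R) := by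
  exact (AddMonoidAlgebra.lift_single _ _ _).trans (by simp)

theorem exists_generator (L : LinearisedLineBundle G X) (y : Pt X K) :
    ∃ e : ∀ (R : Type u) [CommRing R] [Algebra k R] [Algebra K R] [IsScalarTower k K R],
        L.fib (y.baseChange R),
      (∀ (R : Type u) [CommRing R] [Algebra k R] [Algebra K R] [IsScalarTower k K R]
        (v : L.fib (y.baseChange R)), ∃! r : R, r • e R = v) ∧
      ∀ (R S : Type u) [CommRing R] [Algebra k R] [Algebra K R] [IsScalarTower k K R] [CommRing S]
        [Algebra k S] [Algebra K S] [IsScalarTower k K S] (f : R →ₐ[K] S),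
        L.pull (f.restrictScalars k) _ _ (y.baseChange_map f) (e R) = e S := by
  obtain ⟨e, he0, he⟩ := finrank_eq_one_iff'.1 (Module.Invertible.finrank_eq_one K (L.fib y))
  refine ⟨fun R _ _ _ _ => L.pull (IsScalarTower.toAlgHom k K R) y _ rfl e, ?_, ?_⟩
  · intro R _ _ _ _ v
    have hs : ∀ v, ∃ r : R, r • L.pull (IsScalarTower.toAlgHom k K R) y (y.baseChange R) rfl e = v := by
      intro v
      have hv : v ∈ Submodule.span R
          (Set.range (L.pull (IsScalarTower.toAlgHom k K R) y (y.baseChange R) rfl)) := by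
        rw [L.span_pull]; trivial
      rw [← Submodule.mem_span_singleton]
      refine Submodule.span_le.2 ?_ hv
      rintro _ ⟨w, rfl⟩
      obtain ⟨c, rfl⟩ := he w
      rw [LinearMap.map_smulₛₗ]
      exact Submodule.smul_mem _ _ (Submodule.mem_span_singleton_self _)
    obtain ⟨r, hr⟩ := hs v
    refine ⟨r, hr, fun r' hr' => ?_⟩
    refine FaithfulSMul.eq_of_smul_eq_smul (α := L.fib (y.baseChange R)) fun w => ?_
    obtain ⟨c, rfl⟩ := hs w
    rw [smul_comm r', smul_comm r, hr]
    exact congrArg _ hr'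
  · intro R S _ _ _ _ _ _ _ _ f
    have key : ∀ (a : K →ₐ[k] S) (_ : a = IsScalarTower.toAlgHom k K S)
        (h : y.map a = y.baseChange S), L.pull a y _ h e =
          L.pull (IsScalarTower.toAlgHom k K S) y _ rfl e := by
      rintro _ rfl _; rfl
    have hc : (f.restrictScalars k).comp (IsScalarTower.toAlgHom k K R) =
        IsScalarTower.toAlgHom k K S := by
      ext a; exact f.commutes a
    exact (L.pull_pull _ _ y _ _ rfl (y.baseChange_map f) (by rw [hc]) e).trans (key _ hc _)

theorem OnePS.exists_hasWeight (lam : OnePS K G) {y : Pt X K} (hy : lam.Fixes y)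
    (L : LinearisedLineBundle G X) : ∃ r : ℤ, lam.HasWeight y L r := by
  obtain ⟨e, he, hpull⟩ := exists_generator L y
  have inj : ∀ (R : Type u) [CommRing R] [Algebra k R] [Algebra K R] [IsScalarTower k K R] (a b : R),
      a • e R = b • e R → a = b := fun R _ _ _ _ a b h => (he R (b • e R)).unique h rfl
  obtain ⟨c, hc, -⟩ := he _ (L.act (lam.app K[T;T⁻¹] (unitT K)) _ _ (hy _ _) (e _))
  have hact : ∀ (R : Type u) [CommRing R] [Algebra k R] [Algebra K R] [IsScalarTower k K R] (u : Rˣ)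
      (g : Pt G R) (_ : g = lam.app R u) (h : g • y.baseChange R = y.baseChange R),
      L.act g _ _ h (e R) = evalUnit u c • e R := by
    rintro R _ _ _ _ u g hg h
    have hg' : g = (lam.app K[T;T⁻¹] (unitT K)).map ((evalUnit (K := K) u).restrictScalars k) := by
      rw [hg, ← lam.naturality]
      congr 1
      ext
      exact (congrArg Units.val (zpow_one u)).symm.trans (evalUnit_T (K := K) u 1).symm
    subst hg'
    have := L.pull_act ((evalUnit (K := K) u).restrictScalars k) _ _ _ _ _ (hy _ (unitT K))
      (y.baseChange_map _) (y.baseChange_map _) h (e _)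
    rw [← hc, hpull, LinearMap.map_smulₛₗ, hpull] at this
    exact this.symm
  have hone : ∀ (R : Type u) [CommRing R] [Algebra k R] [Algebra K R] [IsScalarTower k K R],
      evalUnit (1 : Rˣ) c = 1 := by
    intro R _ _ _ _
    apply inj
    have h : (1 : Pt G R) • y.baseChange R = y.baseChange R := by
      rw [← map_one (lam.app R)]; exact hy _ _
    rw [← hact R 1 1 (map_one _).symm h, L.act_one, one_smul]
  have hmul : ∀ (R : Type u) [CommRing R] [Algebra k R] [Algebra K R] [IsScalarTower k K R]
      (u v : Rˣ), evalUnit (u * v) c = evalUnit u c * evalUnit v c := by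
    intro R _ _ _ _ u v
    apply inj
    have h : (lam.app R u * lam.app R v) • y.baseChange R = y.baseChange R := by
      rw [← map_mul]; exact hy _ _
    rw [← hact R (u * v) _ (map_mul _ _ _).symm h, ← L.act_act (lam.app R v) (lam.app R u) _ _ _
      (hy _ v) (hy _ u), hact R v _ rfl, map_smul, hact R u _ rfl, smul_smul, mul_comm]
  have hgl : IsGroupLikeElem K c := by
    let A := K[T;T⁻¹] ⊗[K] K[T;T⁻¹]
    let u₁ : Aˣ := Units.map (Algebra.TensorProduct.includeLeft (R := K) (S := K) (A := K[T;T⁻¹]) (B := K[T;T⁻¹]) : K[T;T⁻¹] →* A) (unitT K)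
    let u₂ : Aˣ := Units.map (Algebra.TensorProduct.includeRight (R := K) (A := K[T;T⁻¹]) (B := K[T;T⁻¹]) : K[T;T⁻¹] →* A) (unitT K)
    have hext : ∀ {B : Type u} [CommRing B] [Algebra K B] (F F' : K[T;T⁻¹] →ₐ[K] B),
        F (unitT K) = F' (unitT K) → F = F' := by
      intro B _ _ F F' h
      refine AddMonoidAlgebra.algHom_ext' (MonoidHom.ext_mint h) (Subsingleton.elim _ _)
    have hT {B : Type u} [CommRing B] [Algebra K B] (u : Bˣ) : evalUnit (K := K) u (unitT K) = u :=
      (evalUnit_T u 1).trans (congrArg Units.val (zpow_one u))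
    have h1 : evalUnit (K := K) u₁ = Algebra.TensorProduct.includeLeft := hext _ _ (hT _)
    have h2 : evalUnit (K := K) u₂ = Algebra.TensorProduct.includeRight := hext _ _ (hT _)
    have h3 : evalUnit (K := K) (u₁ * u₂) = Bialgebra.comulAlgHom K K[T;T⁻¹] := by
      refine hext _ _ ((hT _).trans ?_)
      refine Eq.trans ?_ (LaurentPolynomial.comul_T (R := K) (A := K) 1).symm
      simp only [u₁, u₂, unitT, Units.val_mul]
      change LaurentPolynomial.T 1 ⊗ₜ[K] 1 * 1 ⊗ₜ[K] LaurentPolynomial.T 1 = _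
      rw [Algebra.TensorProduct.tmul_mul_tmul, one_mul, mul_one]
    have h4 : evalUnit (K := K) (1 : Kˣ) = Bialgebra.counitAlgHom K K[T;T⁻¹] := by
      refine hext _ _ ((hT _).trans ?_)
      simp [unitT]
    constructor
    · have := hone K
      rwa [h4] at this
    · have := hmul A u₁ u₂
      rw [h1, h2, h3] at this
      refine this.trans ?_
      rw [Algebra.TensorProduct.includeLeft_apply, Algebra.TensorProduct.includeRight_apply,
        Algebra.TensorProduct.tmul_mul_tmul, one_mul, mul_one]
  obtain ⟨r, hr⟩ := AddMonoidAlgebra.isGroupLikeElem_iff_mem_range_of.1 hgl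
  refine ⟨r.toAdd, fun R _ _ _ _ u h v => ?_⟩
  obtain ⟨a, rfl, -⟩ := he R v
  rw [map_smul, hact R u _ rfl, ← evalUnit_T (K := K) u, smul_comm]
  rw [← hr]
  rfl

theorem OnePS.HasWeight.unique {lam : OnePS K G} {y : Pt X K} (hy : lam.Fixes y)
    {L : LinearisedLineBundle G X} {r s : ℤ} (hr : lam.HasWeight y L r)
    (hs : lam.HasWeight y L s) : r = s := by
  obtain ⟨e, he, -⟩ := exists_generator L y
  have h := (hr K[T;T⁻¹] (unitT K) (hy _ _) (e _)).symm.trans (hs _ _ (hy _ _) (e _))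
  have h' := (he _ _).unique h rfl
  have hpow (n : ℤ) : ((unitT K ^ n : K[T;T⁻¹]ˣ) : K[T;T⁻¹]) = LaurentPolynomial.T n := by
    rw [← evalUnit_T (K := K)]
    have : evalUnit (unitT K) = AlgHom.id K K[T;T⁻¹] := by
      refine AddMonoidAlgebra.algHom_ext' (MonoidHom.ext_mint ?_) (Subsingleton.elim _ _)
      exact (evalUnit_T (unitT K) 1).trans (congrArg Units.val (zpow_one (unitT K)))
    rw [this]; rfl
  rw [hpow, hpow] at h'
  exact (AddMonoidAlgebra.single_left_injective (one_ne_zero (α := K))) h'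

theorem OnePS.HasWeight.congr {lam : OnePS K G} {y : Pt X K} {L M : LinearisedLineBundle G X}
    {r : ℤ} (hr : lam.HasWeight y L r) : L.Isom M → lam.HasWeight y M r := by
  rintro ⟨e, -, h2⟩ R _ _ _ _ u h v
  obtain ⟨w, rfl⟩ := (e _).surjective v
  rw [← h2, hr, map_smul]

theorem OnePS.HasWeight.tensor {lam : OnePS K G} {y : Pt X K} {L M : LinearisedLineBundle G X}
    {r s : ℤ} (hr : lam.HasWeight y L r) (hs : lam.HasWeight y M s) :
    lam.HasWeight y (L.tensor M) (r + s) := by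
  intro R _ _ _ _ u h v
  change L.fib _ ⊗[R] M.fib _ at v
  change TensorProduct.map _ _ v = _
  induction v with
  | zero => simp
  | add a b ha hb => rw [map_add, smul_add, ha, hb]
  | tmul a b =>
    rw [TensorProduct.map_tmul, hr, hs, TensorProduct.smul_tmul_smul, zpow_add, Units.val_mul]

theorem OnePS.HasWeight.trivial (lam : OnePS K G) (y : Pt X K) :
    lam.HasWeight y (LinearisedLineBundle.trivial G X) 0 := by
  intro R _ _ _ _ u h v
  rw [zpow_zero, Units.val_one, one_smul]
  rfl

/-- The weight with which `λ` acts on the fibre at a fixed point `y`. -/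
def OnePS.weight (lam : OnePS K G) {y : Pt X K} (hy : lam.Fixes y) (L : PicG G X) : ℤ :=
  Quotient.lift (fun L => (lam.exists_hasWeight hy L).choose)
    (fun L M h => ((lam.exists_hasWeight hy L).choose_spec.congr h).unique hy
      (lam.exists_hasWeight hy M).choose_spec) L

theorem OnePS.weight_mk (lam : OnePS K G) {y : Pt X K} (hy : lam.Fixes y)
    {L : LinearisedLineBundle G X} {r : ℤ} (h : lam.HasWeight y L r) :
    lam.weight hy (PicG.mk L) = r :=
  (lam.exists_hasWeight hy L).choose_spec.unique hy h

open Classical in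
/-- The homomorphism `Pic^G(X) → ℤ` sending `L` to the integer `r` such that `λ` acts on the fibre
of `L` at the fixed point `y` via `t ↦ t^r` (and the zero map if `y` is not fixed by `λ`). -/
def OnePS.weightHom (lam : OnePS K G) (y : Pt X K) : Additive (PicG G X) →+ ℤ :=
  if hy : lam.Fixes y then
    { toFun := fun L => lam.weight hy L.toMul
      map_zero' := lam.weight_mk hy (OnePS.HasWeight.trivial lam y)
      map_add' := by
        intro L M
        obtain ⟨L, rfl⟩ := Additive.ofMul.surjective L
        obtain ⟨M, rfl⟩ := Additive.ofMul.surjective M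
        induction L using Quotient.inductionOn with | h L => ?_
        induction M using Quotient.inductionOn with | h M => ?_
        obtain ⟨r, hr⟩ := lam.exists_hasWeight hy L
        obtain ⟨s, hs⟩ := lam.exists_hasWeight hy M
        exact (lam.weight_mk hy (hr.tensor hs)).trans
          (congrArg₂ _ (lam.weight_mk hy hr) (lam.weight_mk hy hs)).symm }
  else 0

theorem OnePS.weightHom_mk (lam : OnePS K G) {y : Pt X K} (hy : lam.Fixes y)
    {L : LinearisedLineBundle G X} {r : ℤ} (h : lam.HasWeight y L r) :
    lam.weightHom y (Additive.ofMul (PicG.mk L)) = r := by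
  rw [weightHom, dif_pos hy]
  exact lam.weight_mk hy h

/-- The real number `μ^l(x, λ)`: the `ℝ`-linear extension to `Pic^G(X)_ℝ` of the homomorphism
`Pic^G(X) → ℤ`, `L ↦ μ^L(x, λ)`, where `λ` acts on `L_{x_∞}` via `t ↦ t^{μ^L(x, λ)}`. -/
def mu (x : Pt X K) (lam : OnePS K G) : VirtualLinearisation G X →ₗ[ℝ] ℝ :=
  (TensorProduct.AlgebraTensorModule.rid ℤ ℝ ℝ).toLinearMap ∘ₗ
    (lam.weightHom (lam.limit x)).toIntLinearMap.baseChange ℝ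

theorem mu_tmul (x : Pt X K) (lam : OnePS K G) (a : ℝ) (L : PicG G X) :
    mu x lam (a ⊗ₜ[ℤ] Additive.ofMul L) = a * lam.weightHom (lam.limit x) (Additive.ofMul L) := by
  simp [mu, mul_comm]

variable {n : ℕ} {T : Torus K G n}

/-- The function `M^l(x) = sup_λ μ^l(x, λ) / ‖λ‖`, where `λ` runs through the non-trivial
one-parameter subgroups of `G_K`. -/
def M (N : T.InvariantNorm) (l : VirtualLinearisation G X) (x : Pt X K) : EReal :=
  ⨆ lam : {lam : OnePS K G // lam.IsNontrivial}, ((mu x lam.1 l / N.norm lam.1 : ℝ) : EReal)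

/-- The set `X^{ss}(l)` of (geometric) points which are semistable with respect to `l`. -/
def semistable (N : T.InvariantNorm) (l : VirtualLinearisation G X) : Set (Pt X K) :=
  {x | M N l x ≤ 0}

/-- The set `X^s(l)` of (geometric) points which are stable with respect to `l`. -/
def stable (N : T.InvariantNorm) (l : VirtualLinearisation G X) : Set (Pt X K) :=
  {x | M N l x < 0}

end Stability
end

end VirtualGIT

namespace VirtualGIT

open MonoidalCategory CartesianMonoidalCategory
open scoped TensorProduct MonObj
-- For fixed `x` and `λ`, the number `μ^l(x, λ) / ‖λ‖` is linear in `l`, so `l ↦ M^l(x)` is a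
-- supremum of linear functions. If these are bounded uniformly in `λ` at both ends of a segment,
-- their slopes along it are bounded too, and the supremum is finite and Lipschitz there. A point
-- semistable for `l` but not for `l'` then has `M = 0` somewhere on the segment, where it is
-- semistable and not stable. Convexity puts the segment inside `H`, a contradiction
-- (`semistable_subset_of_segment`).
--
-- The substance is the uniform bound on the ample cone (`exists_abs_mu_div_norm_le`). Weights are
-- invariant under conjugation, so only cocharacters `a` of `T` matter. Let `a` fix `y` and act on
-- `L_y` with weight `r`, and let `s` be a section of `L^m` with `s(y) ≠ 0`, `y` in an affine chart.
-- Translating `s` by the tautological point of the torus and restricting to the chart gives a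
-- finite sum of terms `T^χ v_χ`. Specialising to `a` and `y` turns it into `u^{mr} s(y) = ∑ u^{⟨χ,
-- a⟩} v_χ(y)`, so `mr = ⟨χ, a⟩` for one of finitely many `χ` that depend only on the chart and the
-- section. Ampleness and compactness leave finitely many charts, and Cauchy–Schwarz bounds `⟨χ, a⟩`
-- by a multiple of `‖a‖`.
-- Affine charts and compactness
theorem Pt.exists_universal {k : Type u} [Field k] {X : Over (Spec (CommRingCat.of k))}
    {U : X.left.Opens} (hU : IsAffineOpen U) :
    ∃ (A : Type u) (_ : CommRing A) (_ : Algebra k A) (x : Pt X A),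
      ∀ (F : Type u) [Field F] [Algebra k F] (y : Pt X F),
        Set.range (y.left : Spec (CommRingCat.of F) → X.left) ⊆ U →
          ∃ f : A →ₐ[k] F, x.map f = y := by
  let ψ : CommRingCat.of k ⟶ Γ(X.left, U) := Spec.preimage (hU.fromSpec ≫ X.hom)
  have hψ : Spec.map ψ = hU.fromSpec ≫ X.hom := Spec.map_preimage _
  let := ψ.hom.toAlgebra
  refine ⟨Γ(X.left, U), inferInstance, inferInstance, Over.homMk hU.fromSpec hψ.symm, ?_⟩
  intro F _ _ y hy
  let g : Spec (CommRingCat.of F) ⟶ Spec Γ(X.left, U) :=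
    IsOpenImmersion.lift hU.fromSpec y.left (by rw [hU.range_fromSpec]; exact hy)
  have hg : g ≫ hU.fromSpec = y.left := IsOpenImmersion.lift_fac ..
  obtain ⟨φ, hφ⟩ := Spec.map_surjective g
  have hc : ψ ≫ φ = CommRingCat.ofHom (algebraMap k F) := by
    apply Spec.map_injective
    rw [Spec.map_comp, hψ, hφ, ← Category.assoc, hg]
    exact Over.w y
  refine ⟨{ φ.hom with commutes' := fun r => congrArg (fun h => h.hom r) hc }, ?_⟩
  ext1
  exact Eq.trans (congrArg (· ≫ hU.fromSpec) hφ) hg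

/-- The torus `T` only has points in `K`-algebras, so the coordinate ring of the chart is tensored
with `K`; a `k`-homomorphism to `K` then extends uniquely to a `K`-homomorphism. -/
theorem Pt.exists_universal_baseChange {k : Type u} [Field k] (K : Type u) [Field K] [Algebra k K]
    {X : Over (Spec (CommRingCat.of k))} {U : X.left.Opens} (hU : IsAffineOpen U) :
    ∃ (A : Type u) (_ : CommRing A) (_ : Algebra k A) (_ : Algebra K A) (_ : IsScalarTower k K A)
      (x : Pt X A), ∀ y : Pt X K,
        Set.range (y.left : Spec (CommRingCat.of K) → X.left) ⊆ U →
          ∃ f : A →ₐ[K] K, x.map (f.restrictScalars k) = y := by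
  obtain ⟨A, _, _, x, hx⟩ := Pt.exists_universal hU
  refine ⟨K ⊗[k] A, inferInstance, inferInstance, inferInstance, inferInstance,
    x.map Algebra.TensorProduct.includeRight, fun y hy => ?_⟩
  obtain ⟨f, rfl⟩ := hx K y hy
  refine ⟨Algebra.TensorProduct.lift (AlgHom.id K K) f fun _ _ => Commute.all _ _, ?_⟩
  rw [Pt.map_map]
  congr 1
  ext a
  simp

theorem IsProjective.compactSpace {k : Type u} [Field k] {X : Over (Spec (CommRingCat.of k))}
    (hX : IsProjective X) : CompactSpace X.left := by
  obtain ⟨n, i, hi⟩ := hX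
  let := MvPolynomial.gradedAlgebra (σ := Fin (n + 1)) (R := k)
  have : IsScalarTower k (MvPolynomial.homogeneousSubmodule (Fin (n + 1)) k 0)
      (MvPolynomial (Fin (n + 1)) k) :=
    ⟨fun a b c => smul_mul_assoc a b.1 c⟩
  -- Finite type over the degree-zero part makes `Proj.toSpecZero` quasi-compact, and its target is
  -- affine.
  have : Algebra.FiniteType (MvPolynomial.homogeneousSubmodule (Fin (n + 1)) k 0)
      (MvPolynomial (Fin (n + 1)) k) :=
    Algebra.FiniteType.of_restrictScalars_finiteType k _ _
  have : CompactSpace (Proj (MvPolynomial.homogeneousSubmodule (Fin (n + 1)) k)) :=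
    QuasiCompact.compactSpace_of_compactSpace (Proj.toSpecZero _)
  have : CompactSpace (projectiveSpace k n).left := this
  exact QuasiCompact.compactSpace_of_compactSpace i.left

/-! ### Characters are bounded by the norm on cocharacters -/

open scoped MatrixOrder Matrix.Norms.L2Operator in
-- Write the Gram matrix as `Bᵀ B` with `B` invertible. Then `‖a‖` is the standard length of `B a`,
-- while `⟨χ, a⟩ = (χ B⁻¹) · (B a)`, and Cauchy–Schwarz gives the bound with `C` the length of `χ
-- B⁻¹`.
theorem Torus.InvariantNorm.exists_abs_pairing_le {k : Type u} [Field k] {K : Type u} [Field K]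
    [Algebra k K] {G : Over (Spec (CommRingCat.of k))} [GrpObj G] {n : ℕ} {T : Torus K G n}
    (N : T.InvariantNorm) (χ : Fin n → ℤ) :
    ∃ C : ℝ, 0 ≤ C ∧ ∀ a : Fin n → ℤ, |((∑ i, χ i * a i : ℤ) : ℝ)| ≤ C * N.ofCochar a := by
  obtain ⟨B, hB⟩ := CStarAlgebra.nonneg_iff_eq_star_mul_self.1 N.posDef.posSemidef.nonneg
  rw [Matrix.star_eq_conjTranspose] at hB
  rw [Matrix.conjTranspose_eq_transpose_of_trivial] at hB
  have hdet : IsUnit B.det := by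
    have := (Matrix.isUnit_iff_isUnit_det _).1 N.posDef.isUnit
    rw [hB, Matrix.det_mul] at this
    exact isUnit_of_mul_isUnit_right this
  let ρ : Fin n → ℝ := Matrix.vecMul (fun i => (χ i : ℝ)) B⁻¹
  refine ⟨√(∑ i, ρ i ^ 2), Real.sqrt_nonneg _, fun a => ?_⟩
  let w : Fin n → ℝ := B.mulVec fun i => (a i : ℝ)
  have h1 : ((∑ i, χ i * a i : ℤ) : ℝ) = ∑ i, ρ i * w i := by
    change _ = ρ ⬝ᵥ w
    rw [← Matrix.dotProduct_mulVec, Matrix.mulVec_mulVec, Matrix.nonsing_inv_mul _ hdet,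
      Matrix.one_mulVec]
    simp [dotProduct]
  have h2 : N.ofCochar a = √(∑ i, w i ^ 2) := by
    rw [ofCochar, hB, ← Matrix.mulVec_mulVec, Matrix.dotProduct_mulVec, Matrix.vecMul_transpose]
    simp [w, dotProduct, sq]
  rw [h1, h2, ← Real.sqrt_mul (Finset.sum_nonneg fun _ _ => sq_nonneg _), ← Real.sqrt_sq_eq_abs]
  exact Real.sqrt_le_sqrt (Finset.sum_mul_sq_le_sq_mul_sq _ _ _)

/-! ### Weights under tensor powers and conjugation -/

/-- Ampleness provides sections of the bare bundle `L^m`, whereas weights need a linearisation. The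
underlying bundles are equal, not just isomorphic, so that sections carry over by rewriting. -/
theorem LinearisedLineBundle.exists_pow {k : Type u} [Field k] (K : Type u) [Field K] [Algebra k K]
    {G X : Over (Spec (CommRingCat.of k))} [GrpObj G] [ModObj G X]
    (L : LinearisedLineBundle G X) (m : ℕ) :
    ∃ M : LinearisedLineBundle G X, M.toLineBundle = L.toLineBundle.pow m ∧
      ∀ (lam : OnePS K G) (y : Pt X K) (r : ℤ), lam.HasWeight y L r → lam.HasWeight y M (m * r) := by
  induction m with
  | zero =>
    refine ⟨trivial G X, rfl, fun lam y r _ => ?_⟩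
    rw [Nat.cast_zero, zero_mul]
    exact OnePS.HasWeight.trivial lam y
  | succ m ih =>
    obtain ⟨M, hM, hw⟩ := ih
    refine ⟨M.tensor L, congrArg (LineBundle.tensor · L.toLineBundle) hM, fun lam y r hr => ?_⟩
    rw [Nat.cast_succ, add_one_mul]
    exact (hw lam y r hr).tensor hr

section

variable {k : Type u} [Field k] {K : Type u} [Field K] [Algebra k K]
  {G X : Over (Spec (CommRingCat.of k))} [GrpObj G] [ModObj G X]

theorem OnePS.conj_app_smul (lam : OnePS K G) (g : Pt G K) (y : Pt X K) (R : Type u) [CommRing R]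
    [Algebra k R] [Algebra K R] [IsScalarTower k K R] (u : Rˣ) :
    (lam.conj g).app R u • (g • y).baseChange R = g.baseChange R • lam.app R u • y.baseChange R := by
  change (g.baseChange R * lam.app R u * (g.baseChange R)⁻¹) • (g • y).baseChange R = _
  rw [show (g • y).baseChange R = g.baseChange R • y.baseChange R from Pt.map_smul .., smul_smul,
    inv_mul_cancel_right, mul_smul]

theorem OnePS.Fixes.conj {lam : OnePS K G} {y : Pt X K} (hy : lam.Fixes y) (g : Pt G K) :
    (lam.conj g).Fixes (g • y) := by
  intro R _ _ _ _ u
  rw [lam.conj_app_smul, hy]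
  exact (Pt.map_smul ..).symm

/-- The isomorphism `L_y ≅ L_{gy}` given by `g` intertwines `λ` with `g λ g⁻¹`. -/
theorem OnePS.HasWeight.conj {lam : OnePS K G} {y : Pt X K} (hy : lam.Fixes y)
    {L : LinearisedLineBundle G X} {r : ℤ} (hr : lam.HasWeight y L r) (g : Pt G K) :
    (lam.conj g).HasWeight (g • y) L r := by
  intro R _ _ _ _ u h v
  have hg : g.baseChange R • y.baseChange R = (g • y).baseChange R := (Pt.map_smul ..).symm
  have hg' : (g.baseChange R)⁻¹ • (g • y).baseChange R = y.baseChange R := Pt.inv_smul_of hg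
  -- `L.act` carries a proof depending on its group element, so the element is made a variable
  -- before substituting; the same device recurs below.
  have key : ∀ (c : Pt G R) (_ : c = g.baseChange R * (lam.app R u * (g.baseChange R)⁻¹))
      (hc : c • (g • y).baseChange R = (g • y).baseChange R),
      L.act c _ _ hc v = L.act (g.baseChange R) _ _ hg (L.act (lam.app R u) _ _ (hy R u)
        (L.act (g.baseChange R)⁻¹ _ _ hg' v)) := by
    rintro _ rfl hc
    rw [L.act_act _ _ _ _ _ hg' (hy R u) (by rw [mul_smul, hg', hy]), L.act_act]
  refine (key _ (mul_assoc _ _ _) h).trans ?_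
  rw [hr, map_smul, L.act_act _ _ _ _ _ hg' hg (by rw [mul_inv_cancel, one_smul])]
  congr 1
  have h1 : ∀ (c : Pt G R) (_ : c = 1) (hc : c • (g • y).baseChange R = (g • y).baseChange R),
      L.act c _ _ hc v = v := by
    rintro _ rfl hc
    exact L.act_one _ _ _
  exact h1 _ (mul_inv_cancel _) _

end

/-! ### Laurent expansions over the coordinate ring of a torus -/

/-- The fibre `L_y` is the base change of `L_x` along `A → A[Γ]`, hence a sum of copies `T^γ L_x`.
Only the existence of a finite expansion is needed, so repeated exponents are harmless. -/
theorem LineBundle.exists_list_sum_pull {k : Type u} [Field k] {X : Over (Spec (CommRingCat.of k))}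
    (L : LineBundle X) {A : Type u} {Γ : Type} [CommRing A] [Algebra k A] [AddCommMonoid Γ] (x : Pt X A)
    (y : Pt X (AddMonoidAlgebra A Γ)) (i : A →ₐ[k] AddMonoidAlgebra A Γ)
    (hi : ∀ a, i a = AddMonoidAlgebra.single 0 a) (h : x.map i = y) (v : L.fib y) :
    ∃ l : List (Γ × L.fib x),
      v = (l.map fun p => AddMonoidAlgebra.single p.1 (1 : A) • L.pull i x y h p.2).sum := by
  have hv : v ∈ Submodule.span (AddMonoidAlgebra A Γ) (Set.range (L.pull i x y h)) := by
    rw [L.span_pull]; trivial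
  induction hv using Submodule.span_induction with
  | mem v hv =>
    obtain ⟨w, rfl⟩ := hv
    refine ⟨[(0, w)], ?_⟩
    rw [List.map_singleton, List.sum_singleton, ← AddMonoidAlgebra.one_def, one_smul]
  | zero => exact ⟨[], rfl⟩
  | add v w _ _ hv hw =>
    obtain ⟨l, rfl⟩ := hv
    obtain ⟨l', rfl⟩ := hw
    exact ⟨l ++ l', by rw [List.map_append, List.sum_append]⟩
  | smul b v _ hv =>
    obtain ⟨l, rfl⟩ := hv
    induction b using AddMonoidAlgebra.induction_linear with
    | zero => exact ⟨[], zero_smul _ _⟩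
    | add b c hb hc =>
      obtain ⟨l₁, h₁⟩ := hb
      obtain ⟨l₂, h₂⟩ := hc
      exact ⟨l₁ ++ l₂, by rw [add_smul, List.map_append, List.sum_append, h₁, h₂]⟩
    | single χ a =>
      -- Multiplication by `a T^χ` shifts exponents by `χ` and scales vectors by `a`.
      refine ⟨l.map fun p => (χ + p.1, a • p.2), ?_⟩
      rw [List.map_map, List.smul_sum, List.map_map]
      congr 2
      funext p
      simp only [Function.comp_apply, LinearMap.map_smulₛₗ, smul_smul]
      congr 1
      refine Eq.trans ?_ (congrArg _ (hi a)).symm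
      rw [AddMonoidAlgebra.single_mul_single, AddMonoidAlgebra.single_mul_single]
      simp

/-- The tautological point of the torus `𝔾_m^n` with values in its coordinate ring. -/
noncomputable def torusCoord (A : Type u) [CommRing A] (n : ℕ) (i : Fin n) :
    (AddMonoidAlgebra A (Fin n → ℤ))ˣ where
  val := AddMonoidAlgebra.single (Pi.single i 1) 1
  inv := AddMonoidAlgebra.single (-Pi.single i 1) 1
  val_inv := by rw [AddMonoidAlgebra.single_mul_single]; simp [AddMonoidAlgebra.one_def]
  inv_val := by rw [AddMonoidAlgebra.single_mul_single]; simp [AddMonoidAlgebra.one_def]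

/-- The homomorphism `A[ℤ^n] → R` extending `f : A → R` and sending `T^χ` to `u^{⟨χ, a⟩}`. -/
noncomputable def evalCochar {K A R : Type u} [CommRing K] [CommRing A] [Algebra K A] [CommRing R] [Algebra K R]
    {n : ℕ} (f : A →ₐ[K] R) (u : Rˣ) (a : Fin n → ℤ) :
    AddMonoidAlgebra A (Fin n → ℤ) →ₐ[K] R :=
  AddMonoidAlgebra.liftNCAlgHom f
    ((Units.coeHom R).comp ((zpowersHom Rˣ u).comp
      (AddMonoidHom.toMultiplicative
        (∑ i, (AddMonoidHom.mulRight (a i)).comp (Pi.evalAddMonoidHom (fun _ => ℤ) i)))))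
    fun _ _ => Commute.all _ _

theorem evalCochar_single {K A R : Type u} [CommRing K] [CommRing A] [Algebra K A] [CommRing R]
    [Algebra K R] {n : ℕ} (f : A →ₐ[K] R) (u : Rˣ) (a χ : Fin n → ℤ) (c : A) :
    evalCochar f u a (AddMonoidAlgebra.single χ c) =
      f c * ((u ^ (∑ i, χ i * a i) : Rˣ) : R) := by
  refine (AddMonoidAlgebra.liftNC_single _ _ _ _).trans ?_
  congr 1
  change ((u ^ (∑ i, (AddMonoidHom.mulRight (a i)).comp (Pi.evalAddMonoidHom (fun _ => ℤ) i)) χ :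
    Rˣ) : R) = _
  rw [AddMonoidHom.finsetSum_apply]
  rfl

/-- Otherwise the coefficient of `T^r` would be `c ≠ 0` on the left and `0` on the right. -/
theorem exists_mem_of_monomial_eq_sum {F : Type u} [Field F] {c : F} (hc : c ≠ 0) {r : ℤ}
    {l : List (ℤ × F)}
    (h : AddMonoidAlgebra.single r c = (l.map fun p => AddMonoidAlgebra.single p.1 p.2).sum) :
    ∃ p ∈ l, p.1 = r := by
  by_contra! hl
  refine hc ?_
  have key : ∀ l : List (ℤ × F), (∀ p ∈ l, p.1 ≠ r) →
      ((l.map fun p => AddMonoidAlgebra.single p.1 p.2).sum : AddMonoidAlgebra F ℤ).coeff r = 0 := by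
    intro l hl
    induction l with
    | nil => simp
    | cons p l ih =>
      rw [List.map_cons, List.sum_cons, AddMonoidAlgebra.coeff_add, Finsupp.add_apply,
        ih fun q hq => hl q (List.mem_cons_of_mem _ hq), add_zero]
      exact Finsupp.single_eq_of_ne (hl p List.mem_cons_self).symm
  have := key l hl
  rw [← h] at this
  exact (Finsupp.single_eq_same (a := r) (b := c)).symm.trans this

open scoped LaurentPolynomial in
theorem val_unitT_zpow (K : Type u) [Field K] (m : ℤ) :
    ((unitT K ^ m : K[T;T⁻¹]ˣ) : K[T;T⁻¹]) = AddMonoidAlgebra.single m 1 := by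
  have h : evalUnit (unitT K) = AlgHom.id K K[T;T⁻¹] :=
    AddMonoidAlgebra.algHom_ext'
      (MonoidHom.ext_mint ((evalUnit_T (unitT K) 1).trans (congrArg Units.val (zpow_one (unitT K)))))
      (Subsingleton.elim _ _)
  rw [← evalUnit_T (K := K), h]
  rfl

/-! ### Torus weights of a global section -/

section

variable {k : Type u} [Field k] {K : Type u} [Field K] [Algebra k K]
  {G X : Over (Spec (CommRingCat.of k))} [GrpObj G] [ModObj G X]

theorem Pt.map_inv {R S : Type u} [CommRing R] [Algebra k R] [CommRing S] [Algebra k S]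
    (f : R →ₐ[k] S) (g : Pt G R) : Pt.map f g⁻¹ = (Pt.map f g)⁻¹ := by
  rw [eq_inv_iff_mul_eq_one, ← Pt.map_mul, inv_mul_cancel, Pt.map_one]

/-- The vector being pulled back is the value at `x` of the translated section `g · s`. As `h` fixes
`y`, so does `h⁻¹`, and `s(g⁻¹ x)` specialises to `s(y)`. Since `s` is global, the chart containing
`x` need not be stable under the torus. -/
theorem LinearisedLineBundle.pull_act_section (L : LinearisedLineBundle G X)
    (s : L.toLineBundle.GlobalSection) {B E : Type u} [CommRing B] [Algebra k B] [CommRing E]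
    [Algebra k E] (φ : B →ₐ[k] E) (g : Pt G B) (x : Pt X B) (h : Pt G E) (y : Pt X E)
    (hg : g.map φ = h) (hx : x.map φ = y) (hy : h • y = y) :
    L.pull φ x y hx (L.act g (g⁻¹ • x) x (smul_inv_smul g x) (s.val (g⁻¹ • x))) =
      L.act h y y hy (s.val y) := by
  subst hg
  have hz : (g⁻¹ • x).map φ = y := by
    rw [Pt.map_smul, hx, Pt.map_inv]
    exact Pt.inv_smul_of hy
  rw [L.pull_act φ g _ _ _ _ (smul_inv_smul g x) hz hx hy, s.pull_val]

theorem Torus.map_app_torusCoord {n : ℕ} (T : Torus K G n) {A E : Type u} [CommRing A] [Algebra k A]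
    [Algebra K A] [IsScalarTower k K A] [CommRing E] [Algebra k E] [Algebra K E]
    [IsScalarTower k K E] (f : A →ₐ[K] E) (u : Eˣ) (a : Fin n → ℤ) :
    (T.app _ (torusCoord A n)).map ((evalCochar f u a).restrictScalars k) =
      (T.cochar a).app E u := by
  rw [← T.naturality]
  refine congrArg (T.app E) (funext fun j => Units.ext ?_)
  refine (evalCochar_single f u a _ 1).trans ?_
  rw [map_one, one_mul]
  congr 2
  simp [Pi.single_apply]

/-- The weight decomposition of the translates of a section by the tautological point of a torus,
evaluated at a fixed point of a one-parameter subgroup. -/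
theorem LinearisedLineBundle.exists_list_weight {n : ℕ} (T : Torus K G n)
    (L : LinearisedLineBundle G X) (s : L.toLineBundle.GlobalSection) {A : Type u} [CommRing A]
    [Algebra k A] [Algebra K A] [IsScalarTower k K A] (x : Pt X A) :
    ∃ l : List ((Fin n → ℤ) × L.fib x), ∀ (E : Type u) [CommRing E] [Algebra k E] [Algebra K E]
      [IsScalarTower k K E] (f : A →ₐ[K] E) (y : Pt X E) (hf : x.map (f.restrictScalars k) = y)
      (u : Eˣ) (a : Fin n → ℤ) (h : (T.cochar a).app E u • y = y),
      L.act ((T.cochar a).app E u) y y h (s.val y) = (l.map fun p =>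
        ((u ^ (∑ i, p.1 i * a i) : Eˣ) : E) • L.pull (f.restrictScalars k) x y hf p.2).sum := by
  let i : A →ₐ[k] AddMonoidAlgebra A (Fin n → ℤ) := AddMonoidAlgebra.singleZeroAlgHom
  have hi : ∀ c, i c = AddMonoidAlgebra.single 0 c := fun c =>
    AddMonoidAlgebra.singleZeroAlgHom_apply c
  clear_value i
  obtain ⟨xB, hxB⟩ : ∃ xB, x.map i = xB := ⟨_, rfl⟩
  obtain ⟨g, hgT⟩ : ∃ g, g = T.app _ (torusCoord A n) := ⟨_, rfl⟩
  -- The expansion is made once over `A[ℤ^n]`, before `E`, `f`, `y`, `u` and `a` are given; this is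
  -- the source of uniformity.
  obtain ⟨l, hl⟩ := L.toLineBundle.exists_list_sum_pull x xB i hi hxB
    (L.act g (g⁻¹ • xB) _ (smul_inv_smul _ _) (s.val _))
  refine ⟨l, fun E _ _ _ _ f y hf u a h => ?_⟩
  have hφi : ((evalCochar f u a).restrictScalars k).comp i = f.restrictScalars k := by
    ext c
    refine (congrArg (evalCochar f u a) (hi c)).trans ((evalCochar_single f u a 0 c).trans ?_)
    simp
  have hx : xB.map ((evalCochar f u a).restrictScalars k) = y := by
    rw [← hxB, Pt.map_map, hφi, hf]
  have hg : g.map ((evalCochar f u a).restrictScalars k) =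
      (T.cochar a).app E u := by
    rw [hgT, T.map_app_torusCoord]
  rw [← L.pull_act_section s _ _ _ _ _ hg hx h, hl, map_list_sum, List.map_map]
  congr 2
  funext p
  rw [Function.comp_apply, LinearMap.map_smulₛₗ]
  congr 1
  · refine (evalCochar_single f u a p.1 1).trans ?_
    rw [map_one, one_mul]
  · rw [L.pull_pull _ _ _ _ _ _ _ (by rw [hφi, hf])]
    have key : ∀ (b : A →ₐ[k] E) (_ : b = f.restrictScalars k) (hb : x.map b = y),
        L.pull b x y hb p.2 = L.pull (f.restrictScalars k) x y hf p.2 := by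
      rintro _ rfl _; rfl
    exact key _ hφi _

open scoped LaurentPolynomial in
/-- Over an affine chart, only finitely many characters of a torus occur as weights on fibres on
which a given global section does not vanish. -/
theorem LinearisedLineBundle.exists_finset_weight {n : ℕ} (T : Torus K G n)
    (L : LinearisedLineBundle G X) (s : L.toLineBundle.GlobalSection) {A : Type u} [CommRing A]
    [Algebra k A] [Algebra K A] [IsScalarTower k K A] (x : Pt X A) :
    ∃ S : Finset (Fin n → ℤ), ∀ (f : A →ₐ[K] K) (y : Pt X K), x.map (f.restrictScalars k) = y →
      s.val y ≠ 0 → ∀ (a : Fin n → ℤ) (r : ℤ), (T.cochar a).Fixes y → (T.cochar a).HasWeight y L r →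
        ∃ χ ∈ S, r = ∑ i, χ i * a i := by
  classical
  obtain ⟨l, hl⟩ := L.exists_list_weight T s x
  refine ⟨(l.map Prod.fst).toFinset, fun f y hy hs a r hfix hr => ?_⟩
  obtain ⟨e, he, hpull⟩ := exists_generator L y
  have hyK : y.baseChange K = y := by
    rw [Pt.baseChange, show IsScalarTower.toAlgHom k K K = AlgHom.id k K from rfl, Pt.map_id]
  have hs' : s.val (y.baseChange K) ≠ 0 := by rwa [hyK]
  have hf : x.map (f.restrictScalars k) = y.baseChange K := hy.trans hyK.symm
  choose c hc _ using fun v => he K v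
  -- Constants in `K[T;T⁻¹]`: vectors pulled back from `K` have constant coordinates on the
  -- generator `e`, so powers of `T` come only from the torus action.
  let j : K →ₐ[K] K[T;T⁻¹] := Algebra.ofId K K[T;T⁻¹]
  have hpullE : ∀ v, L.pull (j.restrictScalars k) _ _ (y.baseChange_map j) v =
      j (c v) • e K[T;T⁻¹] := by
    intro v
    conv_lhs => rw [← hc v]
    rw [LinearMap.map_smulₛₗ, hpull]
    rfl
  have hfE : x.map ((j.comp f).restrictScalars k) = y.baseChange K[T;T⁻¹] := by
    rw [← Pt.baseChange_map y j, ← hf, Pt.map_map]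
    rfl
  have hsE : s.val (y.baseChange K[T;T⁻¹]) = j (c (s.val (y.baseChange K))) • e _ := by
    rw [← hpullE, s.pull_val]
  -- Evaluating at the universal unit `u = T` turns exponents into degrees of Laurent polynomials,
  -- which can be compared.
  have h := hl K[T;T⁻¹] (j.comp f) _ hfE (unitT K) a (hfix _ _)
  rw [hr, hsE, smul_smul] at h
  have hmono : ∀ (m : ℤ) (d : K), ((unitT K ^ m : K[T;T⁻¹]ˣ) : K[T;T⁻¹]) * j d =
      AddMonoidAlgebra.single m d := by
    intro m d
    rw [val_unitT_zpow]
    refine (AddMonoidAlgebra.single_mul_single m 0 1 d).trans ?_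
    rw [add_zero, one_mul]
  have hterm : ∀ p : (Fin n → ℤ) × L.fib x,
      ((unitT K ^ (∑ i, p.1 i * a i) : K[T;T⁻¹]ˣ) : K[T;T⁻¹]) •
        L.pull ((j.comp f).restrictScalars k) x _ hfE p.2 =
      AddMonoidAlgebra.single (∑ i, p.1 i * a i) (c (L.pull (f.restrictScalars k) x _ hf p.2)) •
        e K[T;T⁻¹] := by
    intro p
    rw [← hmono, mul_smul, ← hpullE]
    congr 1
    exact (L.pull_pull (f.restrictScalars k) (j.restrictScalars k) _ _ _ hf
      (y.baseChange_map j) hfE p.2).symm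
  rw [funext hterm, hmono] at h
  have h' : AddMonoidAlgebra.single r (c (s.val (y.baseChange K))) =
      ((l.map fun p => (∑ i, p.1 i * a i, c (L.pull (f.restrictScalars k) x _ hf p.2))).map
        fun q => AddMonoidAlgebra.single q.1 q.2).sum := by
    refine (he _ _).unique h ?_
    rw [List.sum_smul, List.map_map, List.map_map]
    rfl
  -- Non-vanishing of `s` at `y` makes the left-hand monomial non-zero.
  have hc0 : c (s.val (y.baseChange K)) ≠ 0 := by
    intro h0
    refine hs' ?_
    rw [← hc (s.val _), h0, zero_smul]
  obtain ⟨q, hq, hqr⟩ := exists_mem_of_monomial_eq_sum hc0 h'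
  obtain ⟨p, hp, rfl⟩ := List.mem_map.1 hq
  exact ⟨p.1, List.mem_toFinset.2 (List.mem_map_of_mem hp), hqr.symm⟩

end

/-! ### The uniform bound on the ample cone -/

section

variable {k : Type u} [Field k] {K : Type u} [Field K] [Algebra k K]
  {G X : Over (Spec (CommRingCat.of k))} [GrpObj G] [ModObj G X]

/-- The weights of the one-parameter subgroups `a` of a torus on the fibres of an ample line bundle
at their fixed points are rational multiples of `⟨χ, a⟩` for finitely many characters `χ`. -/
theorem LinearisedLineBundle.exists_finset_weight_of_isAmple [CompactSpace X.left] {n : ℕ}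
    (T : Torus K G n) (L : LinearisedLineBundle G X) (hL : L.toLineBundle.IsAmple) :
    ∃ S : Finset (Fin n → ℤ), ∀ (y : Pt X K) (a : Fin n → ℤ) (r : ℤ), (T.cochar a).Fixes y →
      (T.cochar a).HasWeight y L r → ∃ χ ∈ S, ∃ m : ℕ, 0 < m ∧ m * r = ∑ i, χ i * a i := by
  classical
  have hloc : ∀ p : X.left, ∃ (U : X.left.Opens) (S : Finset (Fin n → ℤ)), p ∈ U ∧
      ∀ y : Pt X K, Set.range (y.left : Spec (CommRingCat.of K) → X.left) ⊆ U →
        ∀ (a : Fin n → ℤ) (r : ℤ), (T.cochar a).Fixes y →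
          (T.cochar a).HasWeight y L r → ∃ χ ∈ S, ∃ m : ℕ, 0 < m ∧ m * r = ∑ i, χ i * a i := by
    intro p
    obtain ⟨m, hm, s, U, hU, hs, hp⟩ := hL p
    obtain ⟨M, hM, hw⟩ := L.exists_pow K m
    obtain ⟨s, hs⟩ : ∃ s : M.toLineBundle.GlobalSection, s.IsNonvanishingLocus U := by
      rw [hM]
      exact ⟨s, hs⟩
    obtain ⟨A, _, _, _, _, x, hx⟩ := Pt.exists_universal_baseChange K hU
    obtain ⟨S, hS⟩ := M.exists_finset_weight T s x
    refine ⟨U, S, hp, fun y hy a r hfix hr => ?_⟩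
    obtain ⟨f, hf⟩ := hx y hy
    obtain ⟨χ, hχ, h⟩ := hS f y hf ((hs K y).1 hy) a _ hfix (hw _ _ _ hr)
    exact ⟨χ, hχ, m, hm, h⟩
  choose U S hpU hS using hloc
  obtain ⟨t, ht⟩ := isCompact_univ.elim_finite_subcover (fun p => (U p : Set X.left))
    (fun p => (U p).isOpen) fun p _ => Set.mem_iUnion.2 ⟨p, hpU p⟩
  refine ⟨t.biUnion S, fun y a r hfix hr => ?_⟩
  let o : Spec (CommRingCat.of K) := IsLocalRing.closedPoint K
  obtain ⟨p, hp, hpo⟩ := Set.mem_iUnion₂.1 (ht (Set.mem_univ (y.left o)))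
  -- `Spec K` is a single point, so `y` lies entirely in any chart containing its image.
  have hrange : Set.range (y.left : Spec (CommRingCat.of K) → X.left) ⊆ U p := by
    rintro _ ⟨q, rfl⟩
    have : Subsingleton (Spec (CommRingCat.of K)) :=
      inferInstanceAs (Subsingleton (PrimeSpectrum K))
    rwa [show q = o from Subsingleton.elim (α := Spec (CommRingCat.of K)) q o]
  obtain ⟨χ, hχ, h⟩ := hS p y hrange a r hfix hr
  exact ⟨χ, Finset.mem_biUnion.2 ⟨p, hp, hχ⟩, h⟩

theorem LinearisedLineBundle.exists_abs_weight_le [CompactSpace X.left] {n : ℕ}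
    {T : Torus K G n} (N : T.InvariantNorm) (L : LinearisedLineBundle G X)
    (hL : L.toLineBundle.IsAmple) :
    ∃ C : ℝ, 0 ≤ C ∧ ∀ (y : Pt X K) (a : Fin n → ℤ) (r : ℤ), (T.cochar a).Fixes y →
      (T.cochar a).HasWeight y L r → |(r : ℝ)| ≤ C * N.ofCochar a := by
  obtain ⟨S, hS⟩ := L.exists_finset_weight_of_isAmple T hL
  choose C hC0 hC using N.exists_abs_pairing_le
  -- The sum dominates every `C χ`; the factor `m ≥ 1` in `m * r = ⟨χ, a⟩` only helps.
  refine ⟨∑ χ ∈ S, C χ, Finset.sum_nonneg fun χ _ => hC0 χ, fun y a r hfix hr => ?_⟩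
  obtain ⟨χ, hχ, m, hm, h⟩ := hS y a r hfix hr
  calc |(r : ℝ)| ≤ m * |(r : ℝ)| :=
        le_mul_of_one_le_left (abs_nonneg _) (Nat.one_le_cast.2 hm)
    _ = |((∑ i, χ i * a i : ℤ) : ℝ)| := by
        rw [← h, Int.cast_mul, Int.cast_natCast, abs_mul, Nat.abs_cast]
    _ ≤ C χ * N.ofCochar a := hC χ a
    _ ≤ (∑ χ ∈ S, C χ) * N.ofCochar a :=
        mul_le_mul_of_nonneg_right (Finset.single_le_sum (fun χ _ => hC0 χ) hχ)
          (Real.sqrt_nonneg _)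

theorem exists_abs_mu_div_norm_le_of_isAmple [CompactSpace X.left] {n : ℕ} {T : Torus K G n}
    (N : T.InvariantNorm) (L : LinearisedLineBundle G X) (hL : L.toLineBundle.IsAmple) :
    ∃ C : ℝ, ∀ (x : Pt X K) (lam : OnePS K G),
      |mu x lam (1 ⊗ₜ[ℤ] Additive.ofMul (PicG.mk L)) / N.norm lam| ≤ C := by
  obtain ⟨C, hC0, hC⟩ := L.exists_abs_weight_le N hL
  refine ⟨C, fun x lam => ?_⟩
  rw [mu_tmul, one_mul]
  by_cases hfix : lam.Fixes (lam.limit x)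
  · obtain ⟨r, hr⟩ := lam.exists_hasWeight hfix L
    rw [lam.weightHom_mk hfix hr, Torus.InvariantNorm.norm]
    split_ifs with h
    · obtain ⟨g, hg⟩ := h.choose_spec
      -- Conjugating `λ` into `T` moves its fixed point by `g` and keeps the weight, so the bound
      -- for cocharacters applies at `g • lam.limit x`.
      have hbound := hC (g • lam.limit x) h.choose r (hg ▸ hfix.conj g) (hg ▸ hr.conj hfix g)
      have hN : 0 ≤ N.ofCochar h.choose := Real.sqrt_nonneg _
      rw [abs_div, abs_of_nonneg hN]
      exact div_le_of_le_mul₀ hN hC0 hbound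
    -- With no conjugate in `T` the norm takes its default value `0`, and so does the quotient.
    · rwa [div_zero, abs_zero]
  -- At a point not fixed by `λ` the weight homomorphism is zero by convention.
  · rw [OnePS.weightHom, dif_neg hfix]
    simpa using hC0

/-- On the ample cone, the function `l ↦ μ^l(x, λ) / ‖λ‖` is bounded uniformly in `x` and `λ`. -/
theorem exists_abs_mu_div_norm_le [CompactSpace X.left] {n : ℕ} {T : Torus K G n}
    (N : T.InvariantNorm) {l : VirtualLinearisation G X} (hl : l ∈ ampleCone G X) :
    ∃ C : ℝ, ∀ (x : Pt X K) (lam : OnePS K G), |mu x lam l / N.norm lam| ≤ C := by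
  -- Classes admitting a uniform bound form a convex cone, so it suffices to treat the generators of
  -- the ample cone.
  let D : ConvexCone ℝ (VirtualLinearisation G X) :=
    { carrier := {l | ∃ C : ℝ, ∀ (x : Pt X K) (lam : OnePS K G), |mu x lam l / N.norm lam| ≤ C}
      smul_mem' := by
        rintro c hc l ⟨C, hC⟩
        refine ⟨c * C, fun x lam => ?_⟩
        rw [map_smul, smul_eq_mul, mul_div_assoc, abs_mul, abs_of_pos hc]
        exact mul_le_mul_of_nonneg_left (hC x lam) hc.le
      add_mem' := by
        rintro l ⟨C, hC⟩ l' ⟨C', hC'⟩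
        refine ⟨C + C', fun x lam => ?_⟩
        rw [map_add, add_div]
        exact (abs_add_le _ _).trans (add_le_add (hC x lam) (hC' x lam)) }
  refine (ConvexCone.hull_min (C := D) ?_ : ampleCone G X ≤ D) hl
  rintro _ ⟨L, hL, rfl⟩
  exact exists_abs_mu_div_norm_le_of_isAmple N L hL

end

/-! ### Variation of the supremum along a segment -/

theorem EReal.coe_iSup_of_bddAbove {I : Type*} [Nonempty I] {f : I → ℝ}
    (hf : BddAbove (Set.range f)) : ((⨆ i, f i : ℝ) : EReal) = ⨆ i, (f i : EReal) := by
  refine le_antisymm ?_ (iSup_le fun i => EReal.coe_le_coe_iff.2 (le_ciSup hf i))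
  -- Every real `z` above the extended supremum bounds all `f i`, hence bounds the real supremum.
  refine EReal.le_of_forall_lt_iff_le.1 fun z hz => EReal.coe_le_coe_iff.2 (ciSup_le fun i => ?_)
  exact EReal.coe_le_coe_iff.1 ((le_iSup (fun i => (f i : EReal)) i).trans hz.le)

/-- The supremum of a family of affine functions on a segment with uniformly bounded end points is
continuous, so that it vanishes somewhere if it changes sign. -/
theorem exists_iSup_lineMap_eq_zero {I : Type*} [Nonempty I] {f g : I → ℝ} {C C' : ℝ}
    (hf : ∀ i, |f i| ≤ C) (hg : ∀ i, |g i| ≤ C') (h0 : ⨆ i, f i ≤ 0) (h1 : 0 ≤ ⨆ i, g i) :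
    ∃ t ∈ Set.Icc (0 : ℝ) 1, BddAbove (Set.range fun i => (1 - t) * f i + t * g i) ∧
      ⨆ i, ((1 - t) * f i + t * g i) = 0 := by
  have hbdd (t : ℝ) : BddAbove (Set.range fun i => (1 - t) * f i + t * g i) := by
    refine ⟨|1 - t| * C + |t| * C', ?_⟩
    rintro _ ⟨i, rfl⟩
    refine add_le_add ((le_abs_self _).trans ?_) ((le_abs_self _).trans ?_)
    · rw [abs_mul]; exact mul_le_mul_of_nonneg_left (hf i) (abs_nonneg _)
    · rw [abs_mul]; exact mul_le_mul_of_nonneg_left (hg i) (abs_nonneg _)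
  -- Each member is affine in `t` with slope `g i - f i`, at most `C + C'` in absolute value, and a
  -- supremum inherits a common Lipschitz constant.
  have hlip := LipschitzWith.of_le_add_mul' (f := fun t : ℝ => ⨆ i, ((1 - t) * f i + t * g i))
    (C + C') fun s t => by
      refine ciSup_le fun i => ?_
      have hi := le_ciSup (hbdd t) i
      have hd : (s - t) * (g i - f i) ≤ (C + C') * dist s t := by
        rw [Real.dist_eq, mul_comm (C + C')]
        refine (le_abs_self _).trans ?_
        rw [abs_mul]
        refine mul_le_mul_of_nonneg_left ((abs_sub _ _).trans ?_) (abs_nonneg _)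
        linarith [hf i, hg i]
      change _ ≤ (⨆ i, ((1 - t) * f i + t * g i)) + _
      linarith
  obtain ⟨t, ht, h⟩ := intermediate_value_Icc zero_le_one hlip.continuous.continuousOn
    (show (0 : ℝ) ∈ Set.Icc _ _ by simpa using ⟨h0, h1⟩)
  exact ⟨t, ht, hbdd t, h⟩

theorem semistable_subset_of_segment {k : Type u} [Field k] {K : Type u} [Field K] [Algebra k K]
    {G X : Over (Spec (CommRingCat.of k))} [GrpObj G] [ModObj G X] [CompactSpace X.left]
    {n : ℕ} {T : Torus K G n} (N : T.InvariantNorm) {l l' : VirtualLinearisation G X}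
    (hl : l ∈ ampleCone G X) (hl' : l' ∈ ampleCone G X)
    (hss : ∀ l₁ ∈ segment ℝ l l', semistable N l₁ = stable N l₁) :
    semistable N l ⊆ semistable N l' := by
  intro x hx
  by_contra hx'
  have hpos : 0 < M N l' x := not_le.1 hx'
  -- An empty supremum is `-∞`, which is not positive.
  have hne : Nonempty {lam : OnePS K G // lam.IsNontrivial} := by
    by_contra! hI
    rw [M, iSup_of_empty] at hpos
    exact not_lt_bot hpos
  obtain ⟨C, hC⟩ := exists_abs_mu_div_norm_le (K := K) N hl
  obtain ⟨C', hC'⟩ := exists_abs_mu_div_norm_le (K := K) N hl'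
  have bdd {D : ℝ} {l₁ : VirtualLinearisation G X}
      (h : ∀ (x : Pt X K) (lam : OnePS K G), |mu x lam l₁ / N.norm lam| ≤ D) :
      BddAbove (Set.range fun lam : {lam : OnePS K G // lam.IsNontrivial} =>
        mu x lam.1 l₁ / N.norm lam.1) :=
    ⟨D, by rintro _ ⟨lam, rfl⟩; exact (le_abs_self _).trans (h x lam.1)⟩
  change M N l x ≤ 0 at hx
  rw [M, ← EReal.coe_iSup_of_bddAbove (bdd hC)] at hx
  rw [M, ← EReal.coe_iSup_of_bddAbove (bdd hC')] at hpos
  obtain ⟨t, ht, hb, h⟩ := exists_iSup_lineMap_eq_zero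
    (fun lam : {lam : OnePS K G // lam.IsNontrivial} => hC x lam.1) (fun lam => hC' x lam.1)
    (EReal.coe_nonpos.1 hx) (EReal.coe_pos.1 hpos).le
  have hM : M N ((1 - t) • l + t • l') x = 0 := by
    have hmu : ∀ lam : {lam : OnePS K G // lam.IsNontrivial},
        mu x lam.1 ((1 - t) • l + t • l') / N.norm lam.1 =
          (1 - t) * (mu x lam.1 l / N.norm lam.1) + t * (mu x lam.1 l' / N.norm lam.1) := by
      intro lam
      rw [map_add, map_smul, map_smul, smul_eq_mul, smul_eq_mul]
      ring
    rw [M]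
    simp only [hmu]
    rw [← EReal.coe_iSup_of_bddAbove hb, h, EReal.coe_zero]
  -- At the zero of `M` the point `x` is semistable, so the hypothesis on the segment would make it
  -- stable, forcing `M < 0`.
  have hmem : x ∈ semistable N ((1 - t) • l + t • l') := hM.le
  rw [hss _ ⟨1 - t, t, sub_nonneg.2 ht.2, ht.1, sub_add_cancel 1 t, rfl⟩] at hmem
  exact (show M N ((1 - t) • l + t • l') x < 0 from hmem).ne hM


end VirtualGIT

theorem proposition2p7 {k : Type u} [Field k]
    (X : Over (Spec (CommRingCat.of k))) (hX : VirtualGIT.IsProjective X)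
    (G : Over (Spec (CommRingCat.of k))) [GrpObj G] [IsAffine G.left] [LocallyOfFiniteType G.hom]
    (hG : VirtualGIT.HasTrivialCharacterGroup G) [ModObj G X]
    {K : Type u} [Field K] [Algebra k K] [IsAlgClosed K]
    {n : ℕ} (T : VirtualGIT.Torus K G n) (hT : T.IsMaximal) (N : T.InvariantNorm)
    (H : Set (VirtualGIT.VirtualLinearisation G X)) (hH : Convex ℝ H)
    (hHA : H ⊆ VirtualGIT.ampleCone G X)
    (hss : ∀ l ∈ H, VirtualGIT.semistable N l = VirtualGIT.stable N l) :
    ∀ l ∈ H, ∀ l' ∈ H,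
      VirtualGIT.stable N l = VirtualGIT.semistable N l ∧
      VirtualGIT.semistable N l = VirtualGIT.semistable N l' ∧
      VirtualGIT.semistable N l' = VirtualGIT.stable N l' := by
  have := hX.compactSpace
  have hsub : ∀ l ∈ H, ∀ l' ∈ H, VirtualGIT.semistable N l ⊆ VirtualGIT.semistable N l' :=
    fun l hl l' hl' => VirtualGIT.semistable_subset_of_segment N (hHA hl) (hHA hl')
      fun l₁ h₁ => hss l₁ (hH.segment_subset hl hl' h₁)
  exact fun l hl l' hl' => ⟨(hss l hl).symm,
    (hsub l hl l' hl').antisymm (hsub l' hl' l hl), hss l' hl'⟩
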